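/- Let $\Omega\subset\mathbb{R}^n$ be open, with a mesh $\mathcal{G}_h$: finitely many closed nondegenerate axis-parallel boxes $K$ with pairwise disjoint interiors, such that $\mathrm{int}\,K\subset\Omega\subset\bigcup_{K\in\mathcal{G}_h}K$. Forms are written $\sum_\sigma\omega_\sigma\,dx^\sigma$ over increasing $k$-indices $\sigma$, $L^2\Lambda^k$ has the coefficientwise inner product, and spaces of $k$-forms with $k>n$ are zero. Let $\mathbf{d}^k$ be the weak exterior derivative with domain $H\Lambda^k=\{\omega\in L^2\Lambda^k:\mathbf{d}^k\omega\in L^2\Lambda^{k+1}\}$, and $\boldsymbol\delta_{k}$ the weak codifferential (the formal $L^2$-adjoint of $\mathbf{d}^{k-1}$, which is $\pm\star\mathbf{d}\star$) with domain $H^*\Lambda^{k}=\{\mu\in L^2\Lambda^k:\boldsymbol\delta_k\mu\in L^2\Lambda^{k-1}\}$; let $H_0\Lambda^k$ and $H_0^*\Lambda^k$ be the closures of the smooth compactly supported forms in the respective graph norms. With $\mathcal{P}_0\Lambda^k$ the constant $k$-forms and $\boldsymbol\kappa$ the Koszul operator, put $\mathcal{P}_1^-\Lambda^k=\mathcal{P}_0\Lambda^k+\boldsymbol\kappa\mathcal{P}_0\Lambda^{k+1}$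 and $\mathcal{P}_1^{*,-}\Lambda^k=\star\mathcal{P}_1^-\Lambda^{n-k}$. Let $\mathcal{Q}_1^-\Lambda^k$ be the space of $k$-forms whose $dx^\sigma$-coefficient is a polynomial of degree at most $1$ in each $x_i$ with $i\notin\sigma$ and independent of $x_i$ for $i\in\sigma$, and $\mathcal{Q}_1^{*,-}\Lambda^k=\star\mathcal{Q}_1^-\Lambda^{n-k}$. Let $V^{\mathcal Q}_h\Lambda^k$ (resp. $V^{\mathcal Q}_{h0}\Lambda^k$) be the space of $\omega\in H\Lambda^k(\Omega)$ (resp. $H_0\Lambda^k(\Omega)$) with $\omega|_K\in\mathcal{Q}_1^-\Lambda^k(K)$ for all $K\in\mathcal{G}_h$, and $V^{\mathcal Q,*}_h\Lambda^k$ (resp. $V^{\mathcal Q,*}_{h0}\Lambda^k$) the space of $\mu\in H^*\Lambda^k(\Omega)$ (resp. $H^*_0\Lambda^k(\Omega)$) with $\mu|_K\in\mathcal{Q}_1^{*,-}\Lambda^k(K)$ for all $K$. Let $\mathbf{d}^k_h$ be the exterior derivative taken cell by cell. Define $\boldsymbol W^{\rm def}_h\Lambda^k$ (resp. $\boldsymbol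 W^{\rm def}_{h0}\Lambda^k$) as the space of $\omega_h\in\prod_{K}\mathcal{P}_1^-\Lambda^k(K)$ such that $$\sum_{K\in\mathcal{G}_h}\langle\mathbf{d}^k\omega_h,\mu_h\rangle_{L^2\Lambda^{k+1}(K)}-\langle\omega_h,\boldsymbol\delta_{k+1}\mu_h\rangle_{L^2\Lambda^k(K)}=0$$ for all $\mu_h\in V^{\mathcal Q,*}_{h0}\Lambda^{k+1}$ (resp. all $\mu_h\in V^{\mathcal Q,*}_{h}\Lambda^{k+1}$). Let $\mathbb{I}^{\mathbf{d}^k}_h$ be the operator that on each cell $K$ maps $\omega\in H\Lambda^k(K)$ to the $p\in\mathcal{P}_1^-\Lambda^k(K)$ with $$\langle\mathbf{d}^kp,\mu\rangle_{L^2\Lambda^{k+1}(K)}-\langle p,\boldsymbol\delta_{k+1}\mu\rangle_{L^2\Lambda^k(K)}=\langle\mathbf{d}^k\omega,\mu\rangle_{L^2\Lambda^{k+1}(K)}-\langle\omega,\boldsymbol\delta_{k+1}\mu\rangle_{L^2\Lambda^k(K)}\quad\text{for all }\mu\in\mathcal{P}_1^{*,-}\Lambda^{k+1}(K)$$ if $k<n$,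 and to its $L^2$ projection onto $\mathcal{P}_0\Lambda^n(K)$ if $k=n$. **Theorem.** The following diagrams of linear maps are well defined, their rows are complexes (the composition of any two consecutive maps is zero), and their squares commute: $$\begin{array}{ccccccccccc} \mathbb{R}&\to&V^{\mathcal Q}_h\Lambda^0&\xrightarrow{\mathbf{d}^0}&V^{\mathcal Q}_h\Lambda^1&\xrightarrow{\mathbf{d}^1}&\cdots&\xrightarrow{\mathbf{d}^{n-1}}&V^{\mathcal Q}_h\Lambda^n&\xrightarrow{\mathbf{d}^{n}}&0\\ \|&&\downarrow\mathbb{I}^{\mathbf{d}^0}_h&&\downarrow\mathbb{I}^{\mathbf{d}^1}_h&&&&\downarrow\mathbb{I}^{\mathbf{d}^n}_h&&\\ \mathbb{R}&\to&\boldsymbol W^{\rm def}_h\Lambda^0&\xrightarrow{\mathbf{d}^0_h}&\boldsymbol W^{\rm def}_h\Lambda^1&\xrightarrow{\mathbf{d}^1_h}&\cdots&\xrightarrow{\mathbf{d}^{n-1}_h}&\boldsymbol W^{\rm def}_h\Lambda^n&\xrightarrow{\mathbf{d}^{n}_h}&0 \end{array}$$ where the maps from $\mathbb{R}$ send $c$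 to the constant function $c$, and $$\begin{array}{ccccccccccc} 0&\to&V^{\mathcal Q}_{h0}\Lambda^0&\xrightarrow{\mathbf{d}^0}&V^{\mathcal Q}_{h0}\Lambda^1&\xrightarrow{\mathbf{d}^1}&\cdots&\xrightarrow{\mathbf{d}^{n-1}}&V^{\mathcal Q}_{h0}\Lambda^n&\xrightarrow{\mathbf{d}^{n}}&0\\ &&\downarrow\mathbb{I}^{\mathbf{d}^0}_h&&\downarrow\mathbb{I}^{\mathbf{d}^1}_h&&&&\downarrow\mathbb{I}^{\mathbf{d}^n}_h&&\\ 0&\to&\boldsymbol W^{\rm def}_{h0}\Lambda^0&\xrightarrow{\mathbf{d}^0_h}&\boldsymbol W^{\rm def}_{h0}\Lambda^1&\xrightarrow{\mathbf{d}^1_h}&\cdots&\xrightarrow{\mathbf{d}^{n-1}_h}&\boldsymbol W^{\rm def}_{h0}\Lambda^n&\xrightarrow{\mathbf{d}^{n}_h}&0. \end{array}$$ In particular $\mathbb{I}^{\mathbf{d}^k}_h$ maps $V^{\mathcal Q}_h\Lambda^k$ into $\boldsymbol W^{\rm def}_h\Lambda^k$ and $V^{\mathcal Q}_{h0}\Lambda^k$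 into $\boldsymbol W^{\rm def}_{h0}\Lambda^k$. -/

import Mathlib

open MeasureTheory Filter Topology

noncomputable section

namespace CubicalWhitney

/-! ### Differential forms in coordinates -/

/-- The increasing `k`-indices `σ₁ < ⋯ < σ_k` in an `n`-element set, as `k`-element sets. -/
abbrev IX (n k : ℕ) : Type := {σ : Finset (Fin n) // σ.card = k}

/-- Alternating `k`-forms on `ℝⁿ`, by their coefficients in the orthonormal basis `dx^σ`.
For `k > n` this is the zero space. -/
abbrev Alt (n k : ℕ) : Type := EuclideanSpace ℝ (IX n k)

/-- The sign `(-1)^(number of elements of σ below i)`. -/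
def sgn {n : ℕ} (i : Fin n) (σ : Finset (Fin n)) : ℝ := (-1) ^ (σ.filter (· < i)).card

/-- The index `τ \ {i}`, for `i ∈ τ`. -/
def IX.del {n k : ℕ} (τ : IX n (k + 1)) (i : τ.1) : IX n k :=
  ⟨τ.1.erase i.1, by rw [Finset.card_erase_of_mem i.2, τ.2]; rfl⟩

/-- The index `σ ∪ {i}`, for `i ∉ σ`. -/
def IX.ins {n k : ℕ} (σ : IX n k) (i : (σ.1ᶜ : Finset (Fin n))) : IX n (k + 1) :=
  ⟨insert i.1 σ.1, by rw [Finset.card_insert_of_notMem (Finset.mem_compl.1 i.2), σ.2]⟩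

/-- The partial derivative `∂f/∂x_i`. -/
def pd {n : ℕ} (i : Fin n) (f : (Fin n → ℝ) → ℝ) (x : Fin n → ℝ) : ℝ :=
  fderiv ℝ f x (Pi.single i 1)

/-- The exterior derivative of a (differentiable) form:
`d (f dx^σ) = ∑_{i ∉ σ} ∂_i f dx^i ∧ dx^σ`. -/
def dForm {n k : ℕ} (φ : (Fin n → ℝ) → Alt n k) (x : Fin n → ℝ) : Alt n (k + 1) :=
  WithLp.toLp 2 fun τ => ∑ i : τ.1, sgn i.1 τ.1 * pd i.1 (fun y => φ y (τ.del i)) x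

/-- The codifferential of a (differentiable) form, the formal `L²`-adjoint of `dForm`. In terms of
the Hodge star `hodge` below, it is `(-1)^((k+1)n) ⋆ d ⋆` on `(k+1)`-forms. -/
def codForm {n k : ℕ} (φ : (Fin n → ℝ) → Alt n (k + 1)) (x : Fin n → ℝ) : Alt n k :=
  WithLp.toLp 2 fun σ =>
    -∑ i : (σ.1ᶜ : Finset (Fin n)), sgn i.1 σ.1 * pd i.1 (fun y => φ y (σ.ins i)) x

/-- The Koszul operator at the point `x` (contraction with the position vector):
`κ dx^τ = ∑_j (-1)^(j+1) x_{τ_j} dx^{τ \ τ_j}`. -/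
def koszul {n k : ℕ} (x : Fin n → ℝ) (b : Alt n (k + 1)) : Alt n k :=
  WithLp.toLp 2 fun σ =>
    ∑ i : (σ.1ᶜ : Finset (Fin n)), sgn i.1 σ.1 * x i.1 * b (σ.ins i)

/-- The Hodge star from `k`-forms to `l`-forms, to be used with `k + l = n`:
`⋆ dx^σ = ε dx^{σᶜ}` with the sign `ε` such that `ε dx^{σᶜ} ∧ dx^σ` is the volume form.
(The other common convention differs from it by the factor `(-1)^(kl)`.) -/
def hodge {n : ℕ} (k l : ℕ) : Alt n k →ₗ[ℝ] Alt n l where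
  toFun a := WithLp.toLp 2 fun τ =>
    if h : τ.1ᶜ.card = k then
      (-1) ^ ((τ.1ᶜ ×ˢ τ.1).filter fun p => p.1 < p.2).card * a ⟨τ.1ᶜ, h⟩
    else 0
  map_add' a b := by
    ext τ
    by_cases h : τ.1ᶜ.card = k <;> simp [h, mul_add]
  map_smul' c a := by
    ext τ
    by_cases h : τ.1ᶜ.card = k <;> simp [h, mul_left_comm]

/-! ### Local polynomial spaces -/

/-- The constant `k`-forms `𝒫₀Λᵏ`. -/
def P0 (n k : ℕ) : Submodule ℝ ((Fin n → ℝ) → Alt n k) where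
  carrier := {ω | ∃ a : Alt n k, ω = fun _ => a}
  zero_mem' := ⟨0, rfl⟩
  add_mem' := by
    rintro _ _ ⟨a, rfl⟩ ⟨b, rfl⟩
    exact ⟨a + b, rfl⟩
  smul_mem' := by
    rintro c _ ⟨a, rfl⟩
    exact ⟨c • a, rfl⟩

/-- The Koszul operator on fields of forms, as a linear map. -/
def koszulField (n k : ℕ) : ((Fin n → ℝ) → Alt n (k + 1)) →ₗ[ℝ] ((Fin n → ℝ) → Alt n k) where
  toFun ω x := koszul x (ω x)
  map_add' ω η := by
    ext x σ
    simp [koszul, mul_add, Finset.sum_add_distrib]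
  map_smul' c ω := by
    ext x σ
    simp [koszul, Finset.mul_sum, mul_left_comm]

/-- The Hodge star on fields of forms, as a linear map. -/
def starField (n k l : ℕ) : ((Fin n → ℝ) → Alt n k) →ₗ[ℝ] ((Fin n → ℝ) → Alt n l) where
  toFun ω x := hodge k l (ω x)
  map_add' ω η := by
    ext x σ
    simp
  map_smul' c ω := by
    ext x σ
    simp

/-- The Whitney forms `𝒫₁⁻Λᵏ = 𝒫₀Λᵏ + κ 𝒫₀Λᵏ⁺¹`. -/
def PMinus (n k : ℕ) : Submodule ℝ ((Fin n → ℝ) → Alt n k) :=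
  P0 n k ⊔ (P0 n (k + 1)).map (koszulField n k)

/-- `𝒫₁^{*,-}Λᵏ = ⋆ 𝒫₁⁻Λⁿ⁻ᵏ` (for `k > n` the zero space). -/
def PMinusStar (n k : ℕ) : Submodule ℝ ((Fin n → ℝ) → Alt n k) :=
  (PMinus n (n - k)).map (starField n (n - k) k)

/-- The coefficient space of `dx^σ` in `𝒬₁⁻Λᵏ`: the tensor product over `i` of the polynomials in
`x_i` of degree at most `0` for `i ∈ σ` and at most `1` for `i ∉ σ`. -/
def QCoeff {n : ℕ} (σ : Finset (Fin n)) : Submodule ℝ ((Fin n → ℝ) → ℝ) :=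
  Submodule.span ℝ {f | ∃ p : Fin n → Polynomial ℝ,
    (∀ i, (p i).natDegree ≤ if i ∈ σ then 0 else 1) ∧ f = fun x => ∏ i, (p i).eval (x i)}

/-- The lowest-degree tensor product space `𝒬₁⁻Λᵏ`. -/
def QMinus (n k : ℕ) : Submodule ℝ ((Fin n → ℝ) → Alt n k) where
  carrier := {ω | ∀ σ : IX n k, (fun x => ω x σ) ∈ QCoeff σ.1}
  zero_mem' := fun σ => (QCoeff σ.1).zero_mem
  add_mem' := fun ha hb σ => (QCoeff σ.1).add_mem (ha σ) (hb σ)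
  smul_mem' := fun c _ ha σ => (QCoeff σ.1).smul_mem c (ha σ)

/-- `𝒬₁^{*,-}Λᵏ = ⋆ 𝒬₁⁻Λⁿ⁻ᵏ` (for `k > n` the zero space). -/
def QMinusStar (n k : ℕ) : Submodule ℝ ((Fin n → ℝ) → Alt n k) :=
  (QMinus n (n - k)).map (starField n (n - k) k)

/-! ### `L²` forms, weak derivatives and the spaces `HΛᵏ`, `H₀Λᵏ`, `H*Λᵏ`, `H₀*Λᵏ` -/

/-- The Hilbert space `L²Λᵏ(U)`. -/
abbrev L2Form {n : ℕ} (k : ℕ) (U : Set (Fin n → ℝ)) : Type :=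
  Lp (Alt n k) 2 (volume.restrict U)

/-- The smooth forms with compact support in `U`. -/
structure IsTest {n k : ℕ} (U : Set (Fin n → ℝ)) (φ : (Fin n → ℝ) → Alt n k) : Prop where
  smooth : ContDiff ℝ ((⊤ : ℕ∞) : WithTop ℕ∞) φ
  compact : HasCompactSupport φ
  support : tsupport φ ⊆ U

theorem IsTest.zero {n k : ℕ} {U : Set (Fin n → ℝ)} :
    IsTest U (0 : (Fin n → ℝ) → Alt n k) where
  smooth := contDiff_const
  compact := HasCompactSupport.zero
  support := by simp [tsupport]

theorem IsTest.add {n k : ℕ} {U : Set (Fin n → ℝ)} {φ ψ : (Fin n → ℝ) → Alt n k}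
    (hφ : IsTest U φ) (hψ : IsTest U ψ) : IsTest U (φ + ψ) where
  smooth := hφ.smooth.add hψ.smooth
  compact := hφ.compact.add hψ.compact
  support := (tsupport_add φ ψ).trans (Set.union_subset hφ.support hψ.support)

theorem IsTest.smul {n k : ℕ} {U : Set (Fin n → ℝ)} {φ : (Fin n → ℝ) → Alt n k}
    (hφ : IsTest U φ) (c : ℝ) : IsTest U (c • φ) where
  smooth := contDiff_const.smul hφ.smooth
  compact := hφ.compact.smul_left (f := fun _ => c)
  support := (tsupport_smul_subset_right (fun _ => c) φ).trans hφ.support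

theorem IsTest.differentiableAt {n k : ℕ} {U : Set (Fin n → ℝ)} {φ : (Fin n → ℝ) → Alt n k}
    (hφ : IsTest U φ) (σ : IX n k) (x : Fin n → ℝ) : DifferentiableAt ℝ (fun y => φ y σ) x := by
  have h : Differentiable ℝ φ := hφ.smooth.differentiable (by simp)
  exact (differentiable_euclidean.1 h σ) x

theorem pd_add {n : ℕ} (i : Fin n) {f g : (Fin n → ℝ) → ℝ} {x : Fin n → ℝ}
    (hf : DifferentiableAt ℝ f x) (hg : DifferentiableAt ℝ g x) :
    pd i (fun y => f y + g y) x = pd i f x + pd i g x := by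
  simp [pd, fderiv_fun_add hf hg]

theorem pd_smul {n : ℕ} (i : Fin n) (c : ℝ) {f : (Fin n → ℝ) → ℝ} {x : Fin n → ℝ}
    (hf : DifferentiableAt ℝ f x) : pd i (fun y => c * f y) x = c * pd i f x := by
  simp [pd, fderiv_const_mul hf]

/-- The pairs `(φ, dφ)`, with `φ` a smooth `k`-form with compact support in `U`. -/
def testD {n : ℕ} (k : ℕ) (U : Set (Fin n → ℝ)) :
    Submodule ℝ (L2Form k U × L2Form (k + 1) U) where
  carrier := {p | ∃ φ : (Fin n → ℝ) → Alt n k, IsTest U φ ∧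
    p.1 =ᵐ[volume.restrict U] φ ∧ p.2 =ᵐ[volume.restrict U] dForm φ}
  zero_mem' := by
    refine ⟨0, IsTest.zero, Lp.coeFn_zero _ _ _, (Lp.coeFn_zero _ _ _).trans ?_⟩
    refine Eventually.of_forall fun x => ?_
    ext τ
    simp [dForm, pd]
  add_mem' := by
    rintro p q ⟨φ, hφ, hp1, hp2⟩ ⟨ψ, hψ, hq1, hq2⟩
    refine ⟨φ + ψ, hφ.add hψ, (Lp.coeFn_add _ _).trans (hp1.add hq1),
      ((Lp.coeFn_add _ _).trans (hp2.add hq2)).trans ?_⟩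
    refine Eventually.of_forall fun x => ?_
    ext τ
    simp [dForm, pd_add _ (hφ.differentiableAt _ x) (hψ.differentiableAt _ x), mul_add,
      Finset.sum_add_distrib]
  smul_mem' := by
    rintro c p ⟨φ, hφ, hp1, hp2⟩
    refine ⟨c • φ, hφ.smul c, (Lp.coeFn_smul _ _).trans (hp1.const_smul c),
      ((Lp.coeFn_smul _ _).trans (hp2.const_smul c)).trans ?_⟩
    refine Eventually.of_forall fun x => ?_
    ext τ
    simp [dForm, pd_smul _ c (hφ.differentiableAt _ x), Finset.mul_sum, mul_left_comm]

/-- The pairs `(φ, δφ)`, with `φ` a smooth `(k+1)`-form with compact support in `U`. -/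
def testCod {n : ℕ} (k : ℕ) (U : Set (Fin n → ℝ)) :
    Submodule ℝ (L2Form (k + 1) U × L2Form k U) where
  carrier := {p | ∃ φ : (Fin n → ℝ) → Alt n (k + 1), IsTest U φ ∧
    p.1 =ᵐ[volume.restrict U] φ ∧ p.2 =ᵐ[volume.restrict U] codForm φ}
  zero_mem' := by
    refine ⟨0, IsTest.zero, Lp.coeFn_zero _ _ _, (Lp.coeFn_zero _ _ _).trans ?_⟩
    refine Eventually.of_forall fun x => ?_
    ext τ
    simp [codForm, pd]
  add_mem' := by
    rintro p q ⟨φ, hφ, hp1, hp2⟩ ⟨ψ, hψ, hq1, hq2⟩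
    refine ⟨φ + ψ, hφ.add hψ, (Lp.coeFn_add _ _).trans (hp1.add hq1),
      ((Lp.coeFn_add _ _).trans (hp2.add hq2)).trans ?_⟩
    refine Eventually.of_forall fun x => ?_
    ext τ
    simp only [codForm, Pi.add_apply, PiLp.add_apply,
      pd_add _ (hφ.differentiableAt _ x) (hψ.differentiableAt _ x), mul_add,
      Finset.sum_add_distrib, neg_add]
  smul_mem' := by
    rintro c p ⟨φ, hφ, hp1, hp2⟩
    refine ⟨c • φ, hφ.smul c, (Lp.coeFn_smul _ _).trans (hp1.const_smul c),
      ((Lp.coeFn_smul _ _).trans (hp2.const_smul c)).trans ?_⟩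
    refine Eventually.of_forall fun x => ?_
    ext τ
    simp [codForm, pd_smul _ c (hφ.differentiableAt _ x), Finset.mul_sum, mul_left_comm]

/-- The pairs `(ω, η)` of `L²` forms on `U` such that `dω = η` weakly:
`⟨η, φ⟩ = ⟨ω, δφ⟩` for all smooth `φ` with compact support in `U`. -/
def weakD {n : ℕ} (k : ℕ) (U : Set (Fin n → ℝ)) :
    Submodule ℝ (L2Form k U × L2Form (k + 1) U) where
  carrier := {p | ∀ q ∈ testCod k U, inner ℝ p.2 q.1 = inner ℝ p.1 q.2}
  zero_mem' := fun q _ => by simp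
  add_mem' := fun ha hb q hq => by simp [inner_add_left, ha q hq, hb q hq]
  smul_mem' := fun c _ ha q hq => by simp [inner_smul_left, ha q hq]

/-- The pairs `(μ, ν)` of `L²` forms on `U` such that `δμ = ν` weakly:
`⟨ν, φ⟩ = ⟨μ, dφ⟩` for all smooth `φ` with compact support in `U`. -/
def weakCod {n : ℕ} (k : ℕ) (U : Set (Fin n → ℝ)) :
    Submodule ℝ (L2Form (k + 1) U × L2Form k U) where
  carrier := {p | ∀ q ∈ testD k U, inner ℝ p.2 q.1 = inner ℝ p.1 q.2}
  zero_mem' := fun q _ => by simp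
  add_mem' := fun ha hb q hq => by simp [inner_add_left, ha q hq, hb q hq]
  smul_mem' := fun c _ ha q hq => by simp [inner_smul_left, ha q hq]

/-- The exterior derivative `dᵏ` as an unbounded operator `L²Λᵏ(U) → L²Λᵏ⁺¹(U)`, with domain
`HΛᵏ(U)`. -/
def extD {n : ℕ} (k : ℕ) (U : Set (Fin n → ℝ)) : L2Form k U →ₗ.[ℝ] L2Form (k + 1) U :=
  (weakD k U).toLinearPMap

/-- The codifferential `δ_{k+1}` as an unbounded operator `L²Λᵏ⁺¹(U) → L²Λᵏ(U)`, with domain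
`H*Λᵏ⁺¹(U)`. -/
def codD {n : ℕ} (k : ℕ) (U : Set (Fin n → ℝ)) : L2Form (k + 1) U →ₗ.[ℝ] L2Form k U :=
  (weakCod k U).toLinearPMap

/-- `HΛᵏ(U)`. -/
def H {n : ℕ} (k : ℕ) (U : Set (Fin n → ℝ)) : Submodule ℝ (L2Form k U) := (extD k U).domain

/-- `H₀Λᵏ(U)`: the closure of the smooth compactly supported forms in the graph norm of `d`. -/
def H0 {n : ℕ} (k : ℕ) (U : Set (Fin n → ℝ)) : Submodule ℝ (L2Form k U) :=
  (testD k U).topologicalClosure.map (LinearMap.fst ℝ _ _)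

/-- `H*Λᵏ⁺¹(U)`. -/
def HStar {n : ℕ} (k : ℕ) (U : Set (Fin n → ℝ)) : Submodule ℝ (L2Form (k + 1) U) :=
  (codD k U).domain

/-- `H₀*Λᵏ⁺¹(U)`: the closure of the smooth compactly supported forms in the graph norm of `δ`. -/
def HStar0 {n : ℕ} (k : ℕ) (U : Set (Fin n → ℝ)) : Submodule ℝ (L2Form (k + 1) U) :=
  (testCod k U).topologicalClosure.map (LinearMap.fst ℝ _ _)

/-- The restriction `L²Λᵏ(V) → L²Λᵏ(U)`, for `U ⊆ V`. -/
def restr {n k : ℕ} {U V : Set (Fin n → ℝ)} (h : U ⊆ V) : L2Form k V →ₗ[ℝ] L2Form k U where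
  toFun ω := ((Lp.memLp ω).mono_measure (Measure.restrict_mono h le_rfl)).toLp ω
  map_add' ω η := by
    rw [← MemLp.toLp_add]
    exact MemLp.toLp_congr _ _ (ae_mono (Measure.restrict_mono h le_rfl) (Lp.coeFn_add ω η))
  map_smul' c ω := by
    rw [RingHom.id_apply, ← MemLp.toLp_const_smul]
    exact MemLp.toLp_congr _ _ (ae_mono (Measure.restrict_mono h le_rfl) (Lp.coeFn_smul c ω))

/-- The `L²` forms on `U` that are restrictions of fields in `S`; so `onSet (PMinus n k) U` is
`𝒫₁⁻Λᵏ(U)`. -/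
def onSet {n k : ℕ} (S : Submodule ℝ ((Fin n → ℝ) → Alt n k)) (U : Set (Fin n → ℝ)) :
    Submodule ℝ (L2Form k U) where
  carrier := {ω | ∃ p ∈ S, ω =ᵐ[volume.restrict U] p}
  zero_mem' := ⟨0, S.zero_mem, Lp.coeFn_zero _ _ _⟩
  add_mem' := by
    rintro ω η ⟨p, hp, hωp⟩ ⟨q, hq, hηq⟩
    exact ⟨p + q, S.add_mem hp hq, (Lp.coeFn_add _ _).trans (hωp.add hηq)⟩
  smul_mem' := by
    rintro c ω ⟨p, hp, hωp⟩
    exact ⟨c • p, S.smul_mem c hp, (Lp.coeFn_smul _ _).trans (hωp.const_smul c)⟩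

/-! ### The local adjoint projection -/

/-- The pairs `(ω, p)` with `ω ∈ HΛᵏ(U)`, `p ∈ 𝒫₁⁻Λᵏ(U)` and
`⟨dp, μ⟩ - ⟨p, δμ⟩ = ⟨dω, μ⟩ - ⟨ω, δμ⟩` for all `μ ∈ 𝒫₁^{*,-}Λᵏ⁺¹(U)`; if `k = n`, where this
condition is void, `p` is instead the `L²` projection of `ω` to `𝒫₀Λⁿ(U)`. -/
def adjProjGraph {n : ℕ} (k : ℕ) (U : Set (Fin n → ℝ)) :
    Submodule ℝ (L2Form k U × L2Form k U) where
  carrier := {w | w.2 ∈ onSet (PMinus n k) U ∧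
    (∃ dω dp, (w.1, dω) ∈ (extD k U).graph ∧ (w.2, dp) ∈ (extD k U).graph ∧
      ∀ μ ∈ onSet (PMinusStar n (k + 1)) U, ∀ δμ, (μ, δμ) ∈ (codD k U).graph →
        inner ℝ dp μ - inner ℝ w.2 δμ = inner ℝ dω μ - inner ℝ w.1 δμ) ∧
    (k = n → ∀ c ∈ onSet (P0 n k) U, inner ℝ w.2 c = inner ℝ w.1 c)}
  zero_mem' := ⟨Submodule.zero_mem _, ⟨0, 0, Submodule.zero_mem _, Submodule.zero_mem _,
    fun _ _ _ _ => rfl⟩, fun _ _ _ => rfl⟩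
  add_mem' := by
    rintro a b ⟨ha, ⟨ω, p, h1, h2, h3⟩, h4⟩ ⟨hb, ⟨ω', p', h1', h2', h3'⟩, h4'⟩
    refine ⟨Submodule.add_mem _ ha hb, ⟨ω + ω', p + p', Submodule.add_mem _ h1 h1',
      Submodule.add_mem _ h2 h2', fun μ hμ ν hν => ?_⟩, fun hk c hc => ?_⟩
    · have e := h3 μ hμ ν hν
      have e' := h3' μ hμ ν hν
      simp only [Prod.fst_add, Prod.snd_add, inner_add_left]
      linarith
    · simp only [Prod.fst_add, Prod.snd_add, inner_add_left, h4 hk c hc, h4' hk c hc]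
  smul_mem' := by
    rintro r a ⟨ha, ⟨ω, p, h1, h2, h3⟩, h4⟩
    refine ⟨Submodule.smul_mem _ r ha, ⟨r • ω, r • p, Submodule.smul_mem _ r h1,
      Submodule.smul_mem _ r h2, fun μ hμ ν hν => ?_⟩, fun hk c hc => ?_⟩
    · have e := h3 μ hμ ν hν
      simp only [Prod.smul_fst, Prod.smul_snd, inner_smul_left, ← mul_sub, e]
    · simp only [Prod.smul_fst, Prod.smul_snd, inner_smul_left, h4 hk c hc]

/-- The adjoint projection `𝕀^{dᵏ} : HΛᵏ(U) → 𝒫₁⁻Λᵏ(U)`. -/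
def adjProj {n : ℕ} (k : ℕ) (U : Set (Fin n → ℝ)) : L2Form k U →ₗ.[ℝ] L2Form k U :=
  (adjProjGraph k U).toLinearPMap

/-! ### Meshes and finite element spaces -/

/-- A cubical mesh on `Ω`: finitely many nondegenerate boxes with edges parallel to the axes and
with disjoint interiors, which partition `Ω` up to the boundaries of the boxes. Cells need not meet
face to face: a mesh without hanging nodes is a special case. -/
structure CubicalMesh {n : ℕ} (Ω : Set (Fin n → ℝ)) where
  cells : Finset (BoxIntegral.Box (Fin n))
  disjoint : ∀ K ∈ cells, ∀ K' ∈ cells, K ≠ K' →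
    Disjoint (BoxIntegral.Box.Ioo K) (BoxIntegral.Box.Ioo K')
  interior_subset : ∀ K ∈ cells, BoxIntegral.Box.Ioo K ⊆ Ω
  subset : Ω ⊆ ⋃ K ∈ cells, BoxIntegral.Box.Icc K

variable {n : ℕ} {Ω : Set (Fin n → ℝ)}

/-- The interior of a cell. -/
abbrev CubicalMesh.cell (G : CubicalMesh Ω) (K : G.cells) : Set (Fin n → ℝ) :=
  BoxIntegral.Box.Ioo K.1

/-- The restriction of a form on `Ω` to a cell. -/
abbrev CubicalMesh.res (G : CubicalMesh Ω) {k : ℕ} (K : G.cells) :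
    L2Form k Ω →ₗ[ℝ] L2Form k (G.cell K) :=
  restr (G.interior_subset K.1 K.2)

/-- The forms on `Ω` in `S` whose restriction to each cell is in the local space `L`: the conforming
finite element space for `S` with the shape functions `L`. -/
def CubicalMesh.conforming (G : CubicalMesh Ω) {k : ℕ} (S : Submodule ℝ (L2Form k Ω))
    (L : Submodule ℝ ((Fin n → ℝ) → Alt n k)) : Submodule ℝ (L2Form k Ω) :=
  S ⊓ ⨅ K : G.cells, (onSet L (G.cell K)).comap (G.res K)

/-- `V_h^𝒬 Λᵏ`. -/
def CubicalMesh.V (G : CubicalMesh Ω) (k : ℕ) : Submodule ℝ (L2Form k Ω) :=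
  G.conforming (H k Ω) (QMinus n k)

/-- `V_{h0}^𝒬 Λᵏ`. -/
def CubicalMesh.V0 (G : CubicalMesh Ω) (k : ℕ) : Submodule ℝ (L2Form k Ω) :=
  G.conforming (H0 k Ω) (QMinus n k)

/-- `V_h^{𝒬,*} Λᵏ⁺¹`. -/
def CubicalMesh.VStar (G : CubicalMesh Ω) (k : ℕ) : Submodule ℝ (L2Form (k + 1) Ω) :=
  G.conforming (HStar k Ω) (QMinusStar n (k + 1))

/-- `V_{h0}^{𝒬,*} Λᵏ⁺¹`. -/
def CubicalMesh.VStar0 (G : CubicalMesh Ω) (k : ℕ) : Submodule ℝ (L2Form (k + 1) Ω) :=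
  G.conforming (HStar0 k Ω) (QMinusStar n (k + 1))

/-- The piecewise forms `∏_K L²Λᵏ(K)`. -/
abbrev CubicalMesh.Broken (G : CubicalMesh Ω) (k : ℕ) : Type :=
  (K : G.cells) → L2Form k (G.cell K)

/-- `d_h ω = η`: the exterior derivative, cell by cell. -/
def CubicalMesh.IsBrokenD (G : CubicalMesh Ω) {k : ℕ} (ω : G.Broken k) (η : G.Broken (k + 1)) :
    Prop :=
  ∀ K, (ω K, η K) ∈ (extD k (G.cell K)).graph

/-- `𝕀_h^{dᵏ} ω = p`: the adjoint projection, cell by cell. -/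
def CubicalMesh.IsBrokenProj (G : CubicalMesh Ω) {k : ℕ} (ω p : G.Broken k) : Prop :=
  ∀ K, (ω K, p K) ∈ (adjProj k (G.cell K)).graph

/-- The piecewise Whitney forms `ω_h` such that
`∑_K ⟨dω_h, μ⟩_{L²(K)} - ⟨ω_h, δμ⟩_{L²(K)} = 0` for all `μ ∈ M`. -/
def CubicalMesh.whitneySpace (G : CubicalMesh Ω) {k : ℕ} (M : Submodule ℝ (L2Form (k + 1) Ω)) :
    Submodule ℝ (G.Broken k) where
  carrier := {ω | (∀ K, ω K ∈ onSet (PMinus n k) (G.cell K)) ∧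
    ∃ η, G.IsBrokenD ω η ∧ ∀ μ ∈ M, ∀ δμ, (μ, δμ) ∈ (codD k Ω).graph →
      ∑ K, (inner ℝ (η K) (G.res K μ) - inner ℝ (ω K) (G.res K δμ)) = 0}
  zero_mem' := ⟨fun _ => Submodule.zero_mem _, 0, fun _ => Submodule.zero_mem _,
    fun _ _ _ _ => by simp⟩
  add_mem' := by
    rintro a b ⟨ha, η, h1, h2⟩ ⟨hb, η', h1', h2'⟩
    refine ⟨fun K => Submodule.add_mem _ (ha K) (hb K), η + η',
      fun K => Submodule.add_mem _ (h1 K) (h1' K), fun μ hμ ν hν => ?_⟩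
    have e := h2 μ hμ ν hν
    have e' := h2' μ hμ ν hν
    simp only [Finset.sum_sub_distrib] at e e'
    simp only [Pi.add_apply, inner_add_left, Finset.sum_sub_distrib, Finset.sum_add_distrib]
    linarith
  smul_mem' := by
    rintro r a ⟨ha, η, h1, h2⟩
    refine ⟨fun K => Submodule.smul_mem _ r (ha K), r • η,
      fun K => Submodule.smul_mem _ r (h1 K), fun μ hμ ν hν => ?_⟩
    have e := h2 μ hμ ν hν
    simp only [Pi.smul_apply, inner_smul_left, ← mul_sub, ← Finset.mul_sum, e, mul_zero]

/-- `W_h^def Λᵏ`. -/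
def CubicalMesh.W (G : CubicalMesh Ω) (k : ℕ) : Submodule ℝ (G.Broken k) :=
  G.whitneySpace (G.VStar0 k)

/-- `W_{h0}^def Λᵏ`. -/
def CubicalMesh.W0 (G : CubicalMesh Ω) (k : ℕ) : Submodule ℝ (G.Broken k) :=
  G.whitneySpace (G.VStar k)

end CubicalWhitney

end

/-! Everything rests on one quadrature fact. The `dx^σ`-coefficients of a form in `QMinus` and of a
form in `QMinusStar` have complementary degree restrictions, so their product has degree at most one
in each variable, and the midpoint rule integrates it exactly over a box (`integral_inner_QMinus`).
Since `dForm` preserves `QMinus` and `codForm` preserves `QMinusStar`, the local pairing ⟨dω, μ⟩ -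
⟨ω, δμ⟩ of ω in 𝒬₁⁻ with μ in 𝒬₁^{*,-} depends on ω only through the values of ω and dω at the
centre c of the cell (`pairing_eq`).

A Whitney form can be written a + κ_{x-c} b; its value at c is a and its exterior derivative is the
constant (k+1) b. Hence these two central values can be prescribed freely and determine it. The
Whitney form `centralProj` with the central values of ω therefore has the same pairing as ω against
all of 𝒬₁^{*,-}. Tested on the subspace 𝒫₁^{*,-}, this says that it is the adjoint projection of ω,
once that projection is known to be unique (`eq_zero_of_zero_mem_adjProjGraph`). Tested on
restrictions of a conforming μ and summed over the cells, it turns the condition defining W into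
global integration by parts for ω and μ, which has no boundary term because one of the two lies in
the closure of the compactly supported forms (`exists_proj_mem_whitneySpace`).

The squares commute because ddω = 0: the projection of dω and the derivative of the projection of ω
are both the constant form with value dω(c) (`IsBrokenProj.isBrokenD`). The lower rows are complexes
because δμ is an admissible test form with δδμ = 0 whenever μ is admissible
(`exists_brokenD_mem_whitneySpace`). -/

namespace CubicalWhitney

/-! ### Calculus of smooth forms: signs, d ∘ d = 0, and adjointness of d and δ. -/

section TestForms

variable {n k : ℕ} {U V : Set (Fin n → ℝ)}

/-! ### Index bookkeeping -/

theorem sgn_mul_self (i : Fin n) (σ : Finset (Fin n)) : sgn i σ * sgn i σ = 1 := by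
  rw [sgn, ← pow_add, ← two_mul, pow_mul]
  simp

theorem sgn_erase_self (i : Fin n) (τ : Finset (Fin n)) : sgn i (τ.erase i) = sgn i τ := by
  unfold sgn
  congr 2
  ext j
  simp only [Finset.mem_filter, Finset.mem_erase]
  constructor
  · rintro ⟨⟨_, h⟩, h'⟩
    exact ⟨h, h'⟩
  · rintro ⟨h, h'⟩
    exact ⟨⟨h'.ne, h⟩, h'⟩

theorem sgn_insert_self (i : Fin n) (σ : Finset (Fin n)) : sgn i (insert i σ) = sgn i σ := by
  unfold sgn
  rw [Finset.filter_insert, if_neg (lt_irrefl i)]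

theorem sgn_erase_of_gt {i j : Fin n} (h : j < i) (τ : Finset (Fin n)) :
    sgn j (τ.erase i) = sgn j τ := by
  unfold sgn
  congr 2
  ext l
  simp only [Finset.mem_filter, Finset.mem_erase]
  constructor
  · rintro ⟨⟨_, h⟩, h'⟩
    exact ⟨h, h'⟩
  · rintro ⟨h1, h'⟩
    exact ⟨⟨(h'.trans h).ne, h1⟩, h'⟩

theorem sgn_erase_of_lt {i j : Fin n} (h : i < j) {τ : Finset (Fin n)} (hi : i ∈ τ) :
    sgn j (τ.erase i) = -sgn j τ := by
  unfold sgn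
  have hm : i ∈ τ.filter (· < j) := by simp [hi, h]
  rw [Finset.filter_erase, ← Finset.card_erase_add_one hm, pow_succ]
  simp

theorem sgn_mul_sgn_erase {i j : Fin n} (hij : i ≠ j) {τ : Finset (Fin n)} (hi : i ∈ τ)
    (hj : j ∈ τ) : sgn i τ * sgn j (τ.erase i) = -(sgn j τ * sgn i (τ.erase j)) := by
  rcases lt_or_gt_of_ne hij with h | h
  · rw [sgn_erase_of_lt h hi, sgn_erase_of_gt h]
    ring
  · rw [sgn_erase_of_lt h hj, sgn_erase_of_gt h]
    ring

theorem sigma_mk_eq {P : Finset (Fin n) → Finset (Fin n)} {σ τ : IX n k} (h : σ = τ) (i : Fin n)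
    (hσ : i ∈ P σ.1) (hτ : i ∈ P τ.1) :
    (⟨σ, ⟨i, hσ⟩⟩ : Σ σ : IX n k, P σ.1) = ⟨τ, ⟨i, hτ⟩⟩ := by
  subst h
  rfl

/-- Removing i from τ and adding i to σ are inverse operations on pairs. This reindexing is the
combinatorial half of the adjointness of `dForm` and `codForm`. -/
theorem sum_del_eq_sum_ins (F : Fin n → IX n k → IX n (k + 1) → ℝ) :
    ∑ τ : IX n (k + 1), ∑ i : τ.1, F i.1 (τ.del i) τ =
      ∑ σ : IX n k, ∑ i : (σ.1ᶜ : Finset (Fin n)), F i.1 σ (σ.ins i) := by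
  rw [Finset.sum_sigma', Finset.sum_sigma']
  refine Finset.sum_bij'
    (fun p _ => ⟨p.1.del p.2, ⟨p.2.1, by simp [IX.del]⟩⟩)
    (fun q _ => ⟨q.1.ins q.2, ⟨q.2.1, by simp [IX.ins]⟩⟩) ?_ ?_ ?_ ?_ ?_
  · simp
  · simp
  · rintro ⟨τ, ⟨i, hi⟩⟩ _
    refine sigma_mk_eq (P := fun τ => τ) (Subtype.ext ?_) i _ _
    exact Finset.insert_erase hi
  · rintro ⟨σ, ⟨i, hi⟩⟩ _
    refine sigma_mk_eq (P := fun σ => σᶜ) (Subtype.ext ?_) i _ _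
    exact Finset.erase_insert (Finset.mem_compl.1 hi)
  · rintro ⟨⟨τ, hτ⟩, ⟨i, hi⟩⟩ _
    have : insert i (τ.erase i) = τ := Finset.insert_erase hi
    simp only [IX.del, IX.ins, this]

/-! ### Smooth forms -/

theorem contDiff_pd (i : Fin n) {f : (Fin n → ℝ) → ℝ} (hf : ContDiff ℝ (⊤ : ℕ∞) f) :
    ContDiff ℝ (⊤ : ℕ∞) (pd i f) :=
  (hf.fderiv_right (m := ((⊤ : ℕ∞) : WithTop ℕ∞)) (by simp)).clm_apply contDiff_const

theorem contDiff_coeff {φ : (Fin n → ℝ) → Alt n k} (hφ : ContDiff ℝ (⊤ : ℕ∞) φ) (σ : IX n k) :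
    ContDiff ℝ (⊤ : ℕ∞) (fun x => φ x σ) :=
  contDiff_euclidean.1 hφ σ

theorem contDiff_dForm {φ : (Fin n → ℝ) → Alt n k} (hφ : ContDiff ℝ (⊤ : ℕ∞) φ) :
    ContDiff ℝ (⊤ : ℕ∞) (dForm φ) :=
  contDiff_euclidean.2 fun _ => ContDiff.sum fun i _ =>
    contDiff_const.mul (contDiff_pd i.1 (contDiff_coeff hφ _))

theorem contDiff_codForm {φ : (Fin n → ℝ) → Alt n (k + 1)} (hφ : ContDiff ℝ (⊤ : ℕ∞) φ) :
    ContDiff ℝ (⊤ : ℕ∞) (codForm φ) :=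
  contDiff_euclidean.2 fun _ => (ContDiff.sum fun i _ =>
    contDiff_const.mul (contDiff_pd i.1 (contDiff_coeff hφ _))).neg

theorem pd_eq_zero_of_notMem_tsupport (i : Fin n) {φ : (Fin n → ℝ) → Alt n k} {x : Fin n → ℝ}
    (hx : x ∉ tsupport φ) (σ : IX n k) : pd i (fun y => φ y σ) x = 0 := by
  have h : (fun y => φ y σ) =ᶠ[𝓝 x] fun _ => 0 := by
    filter_upwards [notMem_tsupport_iff_eventuallyEq.1 hx] with y hy
    simp [hy]
  rw [pd, h.fderiv_eq]
  simp

theorem tsupport_dForm_subset (φ : (Fin n → ℝ) → Alt n k) : tsupport (dForm φ) ⊆ tsupport φ := by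
  refine closure_minimal (fun x hx => ?_) (isClosed_tsupport φ)
  by_contra h
  refine hx ?_
  ext τ
  simp [dForm, pd_eq_zero_of_notMem_tsupport _ h]

theorem tsupport_codForm_subset (φ : (Fin n → ℝ) → Alt n (k + 1)) :
    tsupport (codForm φ) ⊆ tsupport φ := by
  refine closure_minimal (fun x hx => ?_) (isClosed_tsupport φ)
  by_contra h
  refine hx ?_
  ext τ
  simp [codForm, pd_eq_zero_of_notMem_tsupport _ h]

theorem IsTest.dForm {φ : (Fin n → ℝ) → Alt n k} (hφ : IsTest U φ) : IsTest U (dForm φ) where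
  smooth := contDiff_dForm hφ.smooth
  compact := hφ.compact.mono' (subset_tsupport _ |>.trans (tsupport_dForm_subset φ))
  support := (tsupport_dForm_subset φ).trans hφ.support

theorem IsTest.codForm {φ : (Fin n → ℝ) → Alt n (k + 1)} (hφ : IsTest U φ) :
    IsTest U (codForm φ) where
  smooth := contDiff_codForm hφ.smooth
  compact := hφ.compact.mono' (subset_tsupport _ |>.trans (tsupport_codForm_subset φ))
  support := (tsupport_codForm_subset φ).trans hφ.support

theorem IsTest.mono {φ : (Fin n → ℝ) → Alt n k} (hφ : IsTest U φ) (h : U ⊆ V) : IsTest V φ :=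
  ⟨hφ.smooth, hφ.compact, hφ.support.trans h⟩

theorem IsTest.memLp {φ : (Fin n → ℝ) → Alt n k} (hφ : IsTest U φ) (S : Set (Fin n → ℝ)) :
    MemLp φ 2 (volume.restrict S) :=
  (hφ.smooth.continuous.memLp_of_hasCompactSupport hφ.compact).restrict S

theorem IsTest.eq_zero {φ : (Fin n → ℝ) → Alt n k} (hφ : IsTest U φ) {x : Fin n → ℝ}
    (hx : x ∉ U) : φ x = 0 :=
  image_eq_zero_of_notMem_tsupport fun h => hx (hφ.support h)

theorem pd_sum {ι : Type*} (s : Finset ι) (i : Fin n) (c : ι → ℝ)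
    {f : ι → (Fin n → ℝ) → ℝ} {x : Fin n → ℝ} (hf : ∀ j ∈ s, DifferentiableAt ℝ (f j) x) :
    pd i (fun y => ∑ j ∈ s, c j * f j y) x = ∑ j ∈ s, c j * pd i (f j) x := by
  unfold pd
  rw [fderiv_fun_sum fun j hj => (hf j hj).const_mul (c j)]
  simp only [FunLike.coe_sum, Finset.sum_apply]
  refine Finset.sum_congr rfl fun j hj => ?_
  rw [fderiv_const_mul (hf j hj)]
  simp

theorem pd_comm (i j : Fin n) {f : (Fin n → ℝ) → ℝ} (hf : ContDiff ℝ (⊤ : ℕ∞) f) (x : Fin n → ℝ) :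
    pd i (pd j f) x = pd j (pd i f) x := by
  have h : ∀ a b : Fin n,
      pd a (pd b f) x = fderiv ℝ (fderiv ℝ f) x (Pi.single a 1) (Pi.single b 1) := by
    intro a b
    have hd : DifferentiableAt ℝ (fderiv ℝ f) x :=
      ((hf.fderiv_right (m := ((⊤ : ℕ∞) : WithTop ℕ∞)) (by simp)).differentiable (by simp)) x
    have := fderiv_clm_apply (c := fderiv ℝ f) (u := fun _ => (Pi.single b 1 : Fin n → ℝ)) hd
      (differentiableAt_const _)
    unfold pd
    rw [this]
    simp
  rw [h, h]
  refine (hf.contDiffAt.isSymmSndFDerivAt ?_).eq _ _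
  rw [minSmoothness_of_isRCLikeNormedField]
  exact WithTop.coe_le_coe.2 (le_top (a := (2 : ℕ∞)))

/-- The double sum runs over ordered pairs of distinct i, j in ρ. Swapping them leaves the mixed
partial unchanged and reverses the sign (`sgn_mul_sgn_erase`), so the terms cancel in pairs. -/
theorem dForm_dForm {φ : (Fin n → ℝ) → Alt n k} (hφ : ContDiff ℝ (⊤ : ℕ∞) φ) (x : Fin n → ℝ) :
    dForm (dForm φ) x = 0 := by
  ext ρ
  have hdiff : ∀ (i : Fin n) (σ : IX n k), Differentiable ℝ (pd i (fun y => φ y σ)) := fun i σ =>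
    (contDiff_pd i (contDiff_coeff hφ σ)).differentiable (by simp)
  have hpd : ∀ i : ρ.1, pd i.1 (fun y => dForm φ y (ρ.del i)) x =
      ∑ j : (ρ.del i).1, sgn j.1 (ρ.del i).1 *
        pd i.1 (pd j.1 (fun y => φ y ((ρ.del i).del j))) x := fun i =>
    pd_sum _ _ _ fun j _ => hdiff _ _ x
  simp only [dForm, PiLp.zero_apply] at hpd ⊢
  simp only [hpd, Finset.mul_sum]
  rw [Finset.sum_sigma']
  refine Finset.sum_involution
    (fun p _ => ⟨⟨p.2.1, Finset.mem_of_mem_erase p.2.2⟩, ⟨p.1.1, by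
      have := p.2.2
      simp only [IX.del, Finset.mem_erase] at this ⊢
      exact ⟨this.1.symm, p.1.2⟩⟩⟩) ?_ ?_ ?_ ?_
  · rintro ⟨⟨i, hi⟩, ⟨j, hj⟩⟩ _
    simp only [IX.del, Finset.mem_erase] at hj
    have h2 : (ρ.1.erase i).erase j = (ρ.1.erase j).erase i := Finset.erase_right_comm
    simp only [IX.del, h2]
    rw [pd_comm i j (contDiff_coeff hφ _), ← mul_assoc, ← mul_assoc,
      sgn_mul_sgn_erase hj.1.symm hi hj.2]
    ring
  · rintro ⟨⟨i, hi⟩, ⟨j, hj⟩⟩ _ _ h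
    simp only [IX.del, Finset.mem_erase] at hj
    simp only [Sigma.mk.injEq, Subtype.mk.injEq] at h
    exact hj.1 h.1
  · simp
  · simp

/-! ### Integration by parts -/

theorem integral_pd_mul (i : Fin n) {f g : (Fin n → ℝ) → ℝ} (hf : ContDiff ℝ (⊤ : ℕ∞) f)
    (hg : ContDiff ℝ (⊤ : ℕ∞) g) (h : HasCompactSupport f ∨ HasCompactSupport g) :
    ∫ x, pd i f x * g x = -∫ x, f x * pd i g x := by
  have hsub : ∀ {u : (Fin n → ℝ) → ℝ}, HasCompactSupport u → HasCompactSupport (pd i u) :=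
    fun hu => hu.fderiv_apply (𝕜 := ℝ) _
  have hf' := (contDiff_pd i hf).continuous
  have hg' := (contDiff_pd i hg).continuous
  have key := integral_mul_fderiv_eq_neg_fderiv_mul_of_integrable (μ := volume) (f := f) (g := g)
    (v := Pi.single i 1) (𝕜 := ℝ) ?_ ?_ ?_ (fun x _ => hf.differentiable (by simp) x)
    (fun x _ => hg.differentiable (by simp) x)
  · exact (neg_eq_iff_eq_neg.2 key).symm
  · refine (hf'.mul hg.continuous).integrable_of_hasCompactSupport ?_
    rcases h with h | h
    · exact (hsub h).mul_right
    · exact h.mul_left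
  · refine (hf.continuous.mul hg').integrable_of_hasCompactSupport ?_
    rcases h with h | h
    · exact h.mul_right
    · exact (hsub h).mul_left
  · refine (hf.continuous.mul hg.continuous).integrable_of_hasCompactSupport ?_
    rcases h with h | h
    · exact h.mul_right
    · exact h.mul_left

theorem hasCompactSupport_coeff {φ : (Fin n → ℝ) → Alt n k} (h : HasCompactSupport φ)
    (σ : IX n k) : HasCompactSupport (fun x => φ x σ) :=
  h.comp_left (g := fun a : Alt n k => a σ) rfl

theorem integral_inner_dForm {f : (Fin n → ℝ) → Alt n k} {g : (Fin n → ℝ) → Alt n (k + 1)}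
    (hf : ContDiff ℝ (⊤ : ℕ∞) f) (hg : ContDiff ℝ (⊤ : ℕ∞) g)
    (h : HasCompactSupport f ∨ HasCompactSupport g) :
    ∫ x, inner ℝ (dForm f x) (g x) = ∫ x, inner ℝ (f x) (codForm g x) := by
  have hsub : ∀ (i : Fin n) {u : (Fin n → ℝ) → ℝ}, HasCompactSupport u →
      HasCompactSupport (pd i u) := fun i _ hu => hu.fderiv_apply (𝕜 := ℝ) _
  have hf' : ∀ i σ, Continuous (pd i fun y => f y σ) := fun i σ =>
    (contDiff_pd i (contDiff_coeff hf σ)).continuous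
  have hg' : ∀ i σ, Continuous (pd i fun y => g y σ) := fun i σ =>
    (contDiff_pd i (contDiff_coeff hg σ)).continuous
  have hcf : ∀ σ, Continuous fun y => f y σ := fun σ => (contDiff_coeff hf σ).continuous
  have hcg : ∀ σ, Continuous fun y => g y σ := fun σ => (contDiff_coeff hg σ).continuous
  have int1 : ∀ i σ τ, Integrable fun x => sgn i τ.1 * (pd i (fun y => f y σ) x * g x τ) := by
    intro i σ τ
    refine (((hf' i σ).mul (hcg τ)).integrable_of_hasCompactSupport ?_).const_mul _
    rcases h with h | h
    · exact (hsub i (hasCompactSupport_coeff h σ)).mul_right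
    · exact (hasCompactSupport_coeff h τ).mul_left
  have int2 : ∀ i σ τ, Integrable fun x => -(sgn i σ.1 * (f x σ * pd i (fun y => g y τ) x)) := by
    intro i σ τ
    refine ((((hcf σ).mul (hg' i τ)).integrable_of_hasCompactSupport ?_).const_mul _).neg
    rcases h with h | h
    · exact (hasCompactSupport_coeff h σ).mul_right
    · exact (hsub i (hasCompactSupport_coeff h τ)).mul_left
  have e1 : ∀ x, inner ℝ (dForm f x) (g x) = ∑ τ : IX n (k + 1), ∑ i : τ.1,
      sgn i.1 τ.1 * (pd i.1 (fun y => f y (τ.del i)) x * g x τ) := by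
    intro x
    simp only [PiLp.inner_apply, RCLike.inner_apply, conj_trivial, dForm, Finset.mul_sum]
    refine Finset.sum_congr rfl fun τ _ => Finset.sum_congr rfl fun i _ => ?_
    ring
  have e2 : ∀ x, inner ℝ (f x) (codForm g x) = ∑ σ : IX n k,
      ∑ i : (σ.1ᶜ : Finset (Fin n)), -(sgn i.1 σ.1 * (f x σ * pd i.1 (fun y => g y (σ.ins i)) x)) := by
    intro x
    simp only [PiLp.inner_apply, RCLike.inner_apply, conj_trivial, codForm, ← Finset.sum_neg_distrib,
      Finset.sum_mul]
    refine Finset.sum_congr rfl fun τ _ => Finset.sum_congr rfl fun i _ => ?_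
    ring
  simp only [e1, e2]
  rw [integral_finsetSum _ fun τ _ => integrable_finsetSum _ fun i _ => int1 _ _ _,
    integral_finsetSum _ fun τ _ => integrable_finsetSum _ fun i _ => int2 _ _ _]
  simp only [integral_finsetSum _ fun i _ => int1 _ _ _,
    integral_finsetSum _ fun i _ => int2 _ _ _, integral_neg, integral_const_mul]
  rw [sum_del_eq_sum_ins fun i σ τ => sgn i τ.1 * ∫ x, pd i (fun y => f y σ) x * g x τ]
  refine Finset.sum_congr rfl fun σ _ => Finset.sum_congr rfl fun i _ => ?_
  have hs : sgn i.1 (σ.ins i).1 = sgn i.1 σ.1 := sgn_insert_self _ _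
  rw [hs, integral_pd_mul i.1 (contDiff_coeff hf σ) (contDiff_coeff hg _)
    (h.imp (hasCompactSupport_coeff · _) (hasCompactSupport_coeff · _)), mul_neg]

end TestForms

/-! ### Weak derivatives as graphs: uniqueness, closures, the complex property, restriction to
subsets. -/

section WeakDerivatives

variable {n k : ℕ} {U V : Set (Fin n → ℝ)}

/-! ### Weak derivatives -/

theorem inner_eq_setIntegral {ω η : L2Form k U} {f g : (Fin n → ℝ) → Alt n k}
    (hf : ω =ᵐ[volume.restrict U] f) (hg : η =ᵐ[volume.restrict U] g) :
    inner ℝ ω η = ∫ x in U, inner ℝ (f x) (g x) := by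
  rw [L2.inner_def]
  refine integral_congr_ae ?_
  filter_upwards [hf, hg] with x h1 h2
  rw [h1, h2]

theorem setIntegral_inner_test {φ : (Fin n → ℝ) → Alt n k} (hφ : IsTest U φ) (h : U ⊆ V)
    (f : (Fin n → ℝ) → Alt n k) :
    ∫ x in V, inner ℝ (f x) (φ x) = ∫ x, inner ℝ (f x) (φ x) :=
  setIntegral_eq_integral_of_forall_compl_eq_zero fun x hx => by
    rw [hφ.eq_zero fun h' => hx (h h'), inner_zero_right]

theorem IsTest.mem_testD {φ : (Fin n → ℝ) → Alt n k} (hφ : IsTest U φ) :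
    ((hφ.memLp U).toLp φ, (hφ.dForm.memLp U).toLp (CubicalWhitney.dForm φ)) ∈ testD k U :=
  ⟨φ, hφ, MemLp.coeFn_toLp (hφ.memLp U), MemLp.coeFn_toLp (hφ.dForm.memLp U)⟩

theorem IsTest.mem_testCod {φ : (Fin n → ℝ) → Alt n (k + 1)} (hφ : IsTest U φ) :
    ((hφ.memLp U).toLp φ, (hφ.codForm.memLp U).toLp (CubicalWhitney.codForm φ)) ∈ testCod k U :=
  ⟨φ, hφ, MemLp.coeFn_toLp (hφ.memLp U), MemLp.coeFn_toLp (hφ.codForm.memLp U)⟩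

/-- The fundamental lemma of the calculus of variations, reduced to scalar test functions g by
testing with g • a for every constant form a. -/
theorem eq_zero_of_forall_inner_test (hU : IsOpen U) (ω : L2Form k U)
    (h : ∀ φ : (Fin n → ℝ) → Alt n k, IsTest U φ → ∫ x in U, inner ℝ (ω x) (φ x) = 0) :
    ω = 0 := by
  rw [Lp.eq_zero_iff_ae_eq_zero]
  have hloc : LocallyIntegrable ω (volume.restrict U) :=
    (Lp.memLp ω).locallyIntegrable (by norm_num)
  have key := hU.ae_eq_zero_of_integral_contDiff_smul_eq_zero (μ := volume.restrict U) (f := ω)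
    (hloc.locallyIntegrableOn U) fun g hg hgc hgU => by
      have hint := hloc.integrable_smul_left_of_hasCompactSupport hg.continuous hgc
      refine ext_inner_left ℝ fun a => ?_
      rw [← integral_inner hint, inner_zero_right]
      have hφ : IsTest U fun x => g x • a :=
        ⟨hg.smul contDiff_const, hgc.smul_right,
          (tsupport_smul_subset_left g fun _ => a).trans hgU⟩
      rw [← h _ hφ]
      refine integral_congr_ae (Eventually.of_forall fun x => ?_)
      simp only [inner_smul_right, real_inner_comm]
  filter_upwards [key, ae_restrict_mem hU.measurableSet] with x h1 h2
  exact h1 h2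

theorem eq_zero_of_zero_mem_weakD (hU : IsOpen U) {η : L2Form (k + 1) U}
    (h : ((0 : L2Form k U), η) ∈ weakD k U) : η = 0 := by
  refine eq_zero_of_forall_inner_test hU η fun φ hφ => ?_
  rw [← inner_eq_setIntegral (ae_eq_refl _) (MemLp.coeFn_toLp (hφ.memLp U)),
    h _ hφ.mem_testCod, inner_zero_left]

theorem eq_zero_of_zero_mem_weakCod (hU : IsOpen U) {ν : L2Form k U}
    (h : ((0 : L2Form (k + 1) U), ν) ∈ weakCod k U) : ν = 0 := by
  refine eq_zero_of_forall_inner_test hU ν fun φ hφ => ?_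
  rw [← inner_eq_setIntegral (ae_eq_refl _) (MemLp.coeFn_toLp (hφ.memLp U)),
    h _ hφ.mem_testD, inner_zero_left]

theorem weakD_unique (hU : IsOpen U) {ω : L2Form k U} {η η' : L2Form (k + 1) U}
    (h : (ω, η) ∈ weakD k U) (h' : (ω, η') ∈ weakD k U) : η = η' := by
  have := Submodule.sub_mem _ h h'
  rw [Prod.mk_sub_mk, sub_self] at this
  exact sub_eq_zero.1 (eq_zero_of_zero_mem_weakD hU this)

theorem weakCod_unique (hU : IsOpen U) {μ : L2Form (k + 1) U} {ν ν' : L2Form k U}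
    (h : (μ, ν) ∈ weakCod k U) (h' : (μ, ν') ∈ weakCod k U) : ν = ν' := by
  have := Submodule.sub_mem _ h h'
  rw [Prod.mk_sub_mk, sub_self] at this
  exact sub_eq_zero.1 (eq_zero_of_zero_mem_weakCod hU this)

/-- `Submodule.toLinearPMap` has the given submodule as its graph only if that submodule is
single-valued; on an open set the weak derivative is. -/
theorem extD_graph (hU : IsOpen U) : (extD k U).graph = weakD k U :=
  Submodule.toLinearPMap_graph_eq _ fun ⟨_, _⟩ hp h0 => by
    obtain rfl := h0
    exact eq_zero_of_zero_mem_weakD hU hp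

theorem codD_graph (hU : IsOpen U) : (codD k U).graph = weakCod k U :=
  Submodule.toLinearPMap_graph_eq _ fun ⟨_, _⟩ hp h0 => by
    obtain rfl := h0
    exact eq_zero_of_zero_mem_weakCod hU hp

theorem mem_H_iff {ω : L2Form k U} : ω ∈ H k U ↔ ∃ η, (ω, η) ∈ weakD k U := by
  rw [H, extD, Submodule.toLinearPMap_domain]
  simp

theorem mem_HStar_iff {μ : L2Form (k + 1) U} : μ ∈ HStar k U ↔ ∃ ν, (μ, ν) ∈ weakCod k U := by
  rw [HStar, codD, Submodule.toLinearPMap_domain]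
  simp

theorem mem_H0_iff {ω : L2Form k U} :
    ω ∈ H0 k U ↔ ∃ η, (ω, η) ∈ (testD k U).topologicalClosure := by
  simp [H0]

theorem mem_HStar0_iff {μ : L2Form (k + 1) U} :
    μ ∈ HStar0 k U ↔ ∃ ν, (μ, ν) ∈ (testCod k U).topologicalClosure := by
  simp [HStar0]

/-- The weak exterior derivative of a smooth form is its exterior derivative. -/
theorem mem_weakD_of_ae_eq {ω : L2Form k U} {η : L2Form (k + 1) U} {f : (Fin n → ℝ) → Alt n k}
    (hf : ContDiff ℝ (⊤ : ℕ∞) f) (hω : ω =ᵐ[volume.restrict U] f)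
    (hη : η =ᵐ[volume.restrict U] dForm f) : (ω, η) ∈ weakD k U := by
  rintro q ⟨φ, hφ, h1, h2⟩
  rw [inner_eq_setIntegral hη h1, inner_eq_setIntegral hω h2,
    setIntegral_inner_test hφ subset_rfl, setIntegral_inner_test hφ.codForm subset_rfl]
  exact integral_inner_dForm hf hφ.smooth (Or.inr hφ.compact)

/-- The weak codifferential of a smooth form is its codifferential. -/
theorem mem_weakCod_of_ae_eq {μ : L2Form (k + 1) U} {ν : L2Form k U}
    {f : (Fin n → ℝ) → Alt n (k + 1)} (hf : ContDiff ℝ (⊤ : ℕ∞) f) (hμ : μ =ᵐ[volume.restrict U] f)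
    (hν : ν =ᵐ[volume.restrict U] codForm f) : (μ, ν) ∈ weakCod k U := by
  rintro q ⟨φ, hφ, h1, h2⟩
  rw [inner_eq_setIntegral hν h1, inner_eq_setIntegral hμ h2,
    setIntegral_inner_test hφ subset_rfl, setIntegral_inner_test hφ.dForm subset_rfl]
  have := integral_inner_dForm hφ.smooth hf (Or.inl hφ.compact)
  simp only [real_inner_comm (dForm _ _), real_inner_comm (φ _)]
  exact this.symm

theorem testD_le_weakD : testD k U ≤ weakD k U := fun _ ⟨_, hφ, h1, h2⟩ =>
  mem_weakD_of_ae_eq hφ.smooth h1 h2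

theorem testCod_le_weakCod : testCod k U ≤ weakCod k U := fun _ ⟨_, hφ, h1, h2⟩ =>
  mem_weakCod_of_ae_eq hφ.smooth h1 h2

/-- Integration by parts without boundary terms for `H₀Λᵏ` and `H*Λᵏ⁺¹`. -/
theorem inner_eq_of_mem_closure_testD {p : L2Form k U × L2Form (k + 1) U}
    (hp : p ∈ (testD k U).topologicalClosure) {q : L2Form (k + 1) U × L2Form k U}
    (hq : q ∈ weakCod k U) : inner ℝ p.2 q.1 = inner ℝ p.1 q.2 := by
  have hcl : IsClosed {p : L2Form k U × L2Form (k + 1) U | inner ℝ p.2 q.1 = inner ℝ p.1 q.2} :=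
    isClosed_eq (continuous_snd.inner continuous_const) (continuous_fst.inner continuous_const)
  refine closure_minimal (fun p hp => ?_) hcl hp
  have := hq p hp
  simp only [Set.mem_ofPred_eq, real_inner_comm q.1, real_inner_comm q.2]
  exact this.symm

/-- Integration by parts without boundary terms for `HΛᵏ` and `H₀*Λᵏ⁺¹`. -/
theorem inner_eq_of_mem_closure_testCod {p : L2Form k U × L2Form (k + 1) U}
    (hp : p ∈ weakD k U) {q : L2Form (k + 1) U × L2Form k U}
    (hq : q ∈ (testCod k U).topologicalClosure) : inner ℝ p.2 q.1 = inner ℝ p.1 q.2 := by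
  have hcl : IsClosed {q : L2Form (k + 1) U × L2Form k U | inner ℝ p.2 q.1 = inner ℝ p.1 q.2} :=
    isClosed_eq (continuous_const.inner continuous_fst) (continuous_const.inner continuous_snd)
  exact closure_minimal (fun q hq => hp q hq) hcl hq

theorem closure_testD_le_weakD : (testD k U).topologicalClosure ≤ weakD k U := fun _ hp _ hq =>
  inner_eq_of_mem_closure_testD hp (testCod_le_weakCod hq)

theorem closure_testCod_le_weakCod : (testCod k U).topologicalClosure ≤ weakCod k U :=
  fun p hp q hq => by
    have := inner_eq_of_mem_closure_testCod (testD_le_weakD hq) hp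
    rw [real_inner_comm, ← this, real_inner_comm]

/-! ### The complex property -/

/-- Integrating by parts twice, ‖δδφ‖² = ⟨ddδδφ, φ⟩ = 0, so d ∘ d = 0 suffices and no second sign
computation is needed. Continuity upgrades vanishing almost everywhere to vanishing everywhere. -/
theorem codForm_codForm {φ : (Fin n → ℝ) → Alt n (k + 1 + 1)} (hφ : IsTest U φ) :
    codForm (codForm φ) = 0 := by
  have hψ := hφ.codForm.codForm
  have hc : Continuous fun x => inner ℝ (codForm (codForm φ) x) (codForm (codForm φ) x) :=
    hψ.smooth.continuous.inner hψ.smooth.continuous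
  have h0 : ∫ x, inner ℝ (codForm (codForm φ) x) (codForm (codForm φ) x) = 0 := by
    rw [← integral_inner_dForm hψ.smooth hφ.codForm.smooth (Or.inl hψ.compact),
      ← integral_inner_dForm hψ.dForm.smooth hφ.smooth (Or.inl hψ.dForm.compact)]
    simp [dForm_dForm hψ.smooth]
  have hcs : HasCompactSupport fun x =>
      inner ℝ (codForm (codForm φ) x) (codForm (codForm φ) x) :=
    hψ.compact.comp_left (g := fun a : Alt n k => inner ℝ a a) (inner_zero_left _)
  have h1 := (integral_eq_zero_iff_of_nonneg (fun x => real_inner_self_nonneg)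
    (hc.integrable_of_hasCompactSupport hcs)).1 h0
  have h2 := (hc.ae_eq_iff_eq volume continuous_const).1 h1
  funext x
  exact inner_self_eq_zero.1 (congrFun h2 x)

theorem testD_snd_zero {p : L2Form k U × L2Form (k + 1) U} (hp : p ∈ testD k U) :
    (p.2, (0 : L2Form (k + 1 + 1) U)) ∈ testD (k + 1) U := by
  obtain ⟨φ, hφ, _, h2⟩ := hp
  refine ⟨dForm φ, hφ.dForm, h2, (Lp.coeFn_zero _ _ _).trans ?_⟩
  exact Eventually.of_forall fun x => (dForm_dForm hφ.smooth x).symm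

theorem testCod_snd_zero {p : L2Form (k + 1 + 1) U × L2Form (k + 1) U}
    (hp : p ∈ testCod (k + 1) U) : (p.2, (0 : L2Form k U)) ∈ testCod k U := by
  obtain ⟨φ, hφ, _, h2⟩ := hp
  refine ⟨codForm φ, hφ.codForm, h2, (Lp.coeFn_zero _ _ _).trans ?_⟩
  rw [codForm_codForm hφ]

/-- The map (ω, η) ↦ (η, 0) is continuous and takes test pairs to test pairs, hence also their
closures. So d sends `H0` to `H0`, with dd = 0. -/
theorem closure_testD_snd_zero {p : L2Form k U × L2Form (k + 1) U}
    (hp : p ∈ (testD k U).topologicalClosure) :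
    (p.2, (0 : L2Form (k + 1 + 1) U)) ∈ (testD (k + 1) U).topologicalClosure :=
  map_mem_closure (f := fun p : L2Form k U × L2Form (k + 1) U =>
    (p.2, (0 : L2Form (k + 1 + 1) U))) (continuous_snd.prodMk continuous_const) hp
    fun _ => testD_snd_zero

theorem closure_testCod_snd_zero {p : L2Form (k + 1 + 1) U × L2Form (k + 1) U}
    (hp : p ∈ (testCod (k + 1) U).topologicalClosure) :
    (p.2, (0 : L2Form k U)) ∈ (testCod k U).topologicalClosure :=
  map_mem_closure (f := fun p : L2Form (k + 1 + 1) U × L2Form (k + 1) U =>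
    (p.2, (0 : L2Form k U))) (continuous_snd.prodMk continuous_const) hp
    fun _ => testCod_snd_zero

/-- Testing dω against δφ, itself a derivative of a test form with δδφ = 0, gives ddω = 0 weakly. -/
theorem weakD_snd_zero {p : L2Form k U × L2Form (k + 1) U} (hp : p ∈ weakD k U) :
    (p.2, (0 : L2Form (k + 1 + 1) U)) ∈ weakD (k + 1) U := fun q hq => by
  have := hp _ (testCod_snd_zero hq)
  simp only [inner_zero_right] at this
  simp [this]

theorem weakCod_snd_zero {p : L2Form (k + 1 + 1) U × L2Form (k + 1) U}
    (hp : p ∈ weakCod (k + 1) U) : (p.2, (0 : L2Form k U)) ∈ weakCod k U := fun q hq => by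
  have := hp _ (testD_snd_zero hq)
  simp only [inner_zero_right] at this
  simp [this]

/-! ### Restriction -/

theorem restr_ae_eq (h : U ⊆ V) (ω : L2Form k V) : restr h ω =ᵐ[volume.restrict U] ω :=
  MemLp.coeFn_toLp ((Lp.memLp ω).mono_measure (Measure.restrict_mono h le_rfl))

/-- A test form on U is also one on V, so pairing it with a restriction is the same as pairing it
with the original form. Weak derivatives thereby restrict to cells. -/
theorem inner_restr_toLp (h : U ⊆ V) (ω : L2Form k V) {q : L2Form k U}
    {φ : (Fin n → ℝ) → Alt n k} (hφ : IsTest U φ) (hq : q =ᵐ[volume.restrict U] φ) :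
    inner ℝ (restr h ω) q = inner ℝ ω (((hφ.mono h).memLp V).toLp φ) := by
  rw [inner_eq_setIntegral (restr_ae_eq h ω) hq,
    inner_eq_setIntegral (ae_eq_refl _) (MemLp.coeFn_toLp ((hφ.mono h).memLp V)),
    setIntegral_inner_test hφ subset_rfl, setIntegral_inner_test hφ h]

theorem weakD_restr (h : U ⊆ V) {ω : L2Form k V} {η : L2Form (k + 1) V}
    (hω : (ω, η) ∈ weakD k V) : (restr h ω, restr h η) ∈ weakD k U := by
  rintro q ⟨φ, hφ, h1, h2⟩
  rw [inner_restr_toLp h η hφ h1, inner_restr_toLp h ω hφ.codForm h2]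
  exact hω _ (hφ.mono h).mem_testCod

theorem weakCod_restr (h : U ⊆ V) {μ : L2Form (k + 1) V} {ν : L2Form k V}
    (hμ : (μ, ν) ∈ weakCod k V) : (restr h μ, restr h ν) ∈ weakCod k U := by
  rintro q ⟨φ, hφ, h1, h2⟩
  rw [inner_restr_toLp h ν hφ h1, inner_restr_toLp h μ hφ.dForm h2]
  exact hμ _ (hφ.mono h).mem_testD

end WeakDerivatives

/-! ### Tensor product polynomials, exactness of midpoint quadrature, and the Hodge star. -/

section Polynomials

variable {n k : ℕ} {s : Finset (Fin n)}

/-! ### Tensor product polynomials -/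

theorem prod_mem_QCoeff {p : Fin n → Polynomial ℝ}
    (hp : ∀ i, (p i).natDegree ≤ if i ∈ s then 0 else 1) :
    (fun x => ∏ i, (p i).eval (x i)) ∈ QCoeff s :=
  Submodule.subset_span ⟨p, hp, rfl⟩

theorem QCoeff_induction {P : (f : (Fin n → ℝ) → ℝ) → f ∈ QCoeff s → Prop}
    (prod : ∀ (p : Fin n → Polynomial ℝ) (hp : ∀ i, (p i).natDegree ≤ if i ∈ s then 0 else 1),
      P (fun x => ∏ i, (p i).eval (x i)) (prod_mem_QCoeff hp))
    (zero : P 0 (QCoeff s).zero_mem)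
    (add : ∀ f hf g hg, P f hf → P g hg → P (f + g) ((QCoeff s).add_mem hf hg))
    (smul : ∀ (c : ℝ) f hf, P f hf → P (c • f) ((QCoeff s).smul_mem c hf))
    {f : (Fin n → ℝ) → ℝ} (hf : f ∈ QCoeff s) : P f hf := by
  induction hf using Submodule.span_induction with
  | mem f h =>
    obtain ⟨p, hp, rfl⟩ := h
    exact prod p hp
  | zero => exact zero
  | add f g hf hg h1 h2 => exact add f hf g hg h1 h2
  | smul c f hf h => exact smul c f hf h

theorem const_mem_QCoeff (c : ℝ) : (fun _ => c) ∈ QCoeff s := by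
  have h := (QCoeff s).smul_mem c (prod_mem_QCoeff (s := s) (p := fun _ => 1) (by simp))
  convert h using 1
  funext x
  simp

theorem coord_mem_QCoeff {i : Fin n} (hi : i ∉ s) : (fun x => x i) ∈ QCoeff s := by
  have h := prod_mem_QCoeff (s := s) (p := fun j => if j = i then Polynomial.X else 1) fun j => by
    by_cases hj : j = i
    · subst hj
      simp [hi]
    · simp [hj]
  convert h using 1
  funext x
  rw [Finset.prod_eq_single i]
  · simp
  · intro j _ hj
    simp [hj]
  · simp

theorem contDiff_eval_coord (p : Polynomial ℝ) (i : Fin n) :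
    ContDiff ℝ (⊤ : ℕ∞) fun x : Fin n → ℝ => p.eval (x i) := by
  have h : ContDiff ℝ (⊤ : ℕ∞) fun x : Fin n → ℝ => p.aeval (x i) :=
    p.contDiff_aeval _ |>.comp (contDiff_apply ℝ ℝ i)
  simpa using h

theorem contDiff_of_mem_QCoeff {f : (Fin n → ℝ) → ℝ} (hf : f ∈ QCoeff s) :
    ContDiff ℝ (⊤ : ℕ∞) f := by
  induction hf using QCoeff_induction with
  | prod p hp => exact contDiff_prod fun i _ => contDiff_eval_coord (p i) i
  | zero => exact contDiff_const
  | add f _ g _ h1 h2 => exact h1.add h2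
  | smul c f _ h => exact contDiff_const.smul h

/-- Differentiation in x_i lowers the degree in x_i to zero, which is the restriction expressed by
adding i to s, and leaves the other degrees alone. -/
theorem pd_mem_QCoeff (i : Fin n) {f : (Fin n → ℝ) → ℝ} (hf : f ∈ QCoeff s) :
    pd i f ∈ QCoeff (insert i s) := by
  induction hf using QCoeff_induction with
  | prod p hp =>
    have hdeg : ∀ j, (Function.update p i (Polynomial.derivative (p i)) j).natDegree ≤
        if j ∈ insert i s then 0 else 1 := by
      intro j
      by_cases hj : j = i
      · subst hj
        have h1 : (p j).natDegree ≤ 1 := (hp j).trans (by split_ifs <;> simp)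
        have h2 := Polynomial.natDegree_derivative_le (p j)
        simp only [Function.update_self, Finset.mem_insert_self, if_true]
        omega
      · simpa [hj] using hp j
    convert prod_mem_QCoeff hdeg using 1
    funext x
    unfold pd
    rw [fderiv_finsetProd fun j _ => ((contDiff_eval_coord (p j) j).differentiable (by simp)) x]
    have hd : ∀ j, fderiv ℝ (fun x : Fin n → ℝ => (p j).eval (x j)) x (Pi.single i 1) =
        if j = i then (Polynomial.derivative (p i)).eval (x i) else 0 := by
      intro j
      have h1 : HasFDerivAt (fun x : Fin n → ℝ => (p j).eval (x j)) _ x :=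
        HasDerivAt.comp_hasFDerivAt (h₂ := fun t => (p j).eval t) x ((p j).hasDerivAt (x j))
          (hasFDerivAt_apply (𝕜 := ℝ) (F' := fun _ : Fin n => ℝ) j x)
      rw [h1.fderiv]
      by_cases hj : j = i
      · subst hj
        simp
      · simp [hj]
    simp only [FunLike.coe_sum, Finset.sum_apply, FunLike.coe_smul,
      Pi.smul_apply, smul_eq_mul, hd, mul_ite, mul_zero, Finset.sum_ite_eq', Finset.mem_univ,
      if_true]
    rw [← Finset.mul_prod_erase _ _ (Finset.mem_univ i), Function.update_self, mul_comm]
    congr 1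
    refine Finset.prod_congr rfl fun j hj => ?_
    rw [Function.update_of_ne (Finset.ne_of_mem_erase hj)]
  | zero =>
    convert (QCoeff (insert i s)).zero_mem using 1
    funext x
    simp [pd]
  | add f hf g hg h1 h2 =>
    convert (QCoeff (insert i s)).add_mem h1 h2 using 1
    funext x
    exact pd_add i ((contDiff_of_mem_QCoeff hf).differentiable (by simp) x)
      ((contDiff_of_mem_QCoeff hg).differentiable (by simp) x)
  | smul c f hf h =>
    convert (QCoeff (insert i s)).smul_mem c h using 1
    funext x
    exact pd_smul i c ((contDiff_of_mem_QCoeff hf).differentiable (by simp) x)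

/-! ### Midpoint quadrature on a box -/

/-- The centre of a box. -/
noncomputable def centre (K : BoxIntegral.Box (Fin n)) : Fin n → ℝ :=
  fun i => (K.lower i + K.upper i) / 2

/-- The volume of a box. -/
noncomputable def vol (K : BoxIntegral.Box (Fin n)) : ℝ := ∏ i, (K.upper i - K.lower i)

theorem vol_pos (K : BoxIntegral.Box (Fin n)) : 0 < vol K :=
  Finset.prod_pos fun i _ => sub_pos.2 (K.lower_lt_upper i)

theorem isOpen_Ioo (K : BoxIntegral.Box (Fin n)) : IsOpen (BoxIntegral.Box.Ioo K) :=
  isOpen_set_pi Set.finite_univ fun _ _ => _root_.isOpen_Ioo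

theorem memLp_two_of_subset_isCompact {E : Type*} [NormedAddCommGroup E]
    [SecondCountableTopology E] {f : (Fin n → ℝ) → E} (hf : Continuous f)
    {S C : Set (Fin n → ℝ)} (hC : IsCompact C) (hS : S ⊆ C) :
    MemLp f 2 (volume.restrict S) := by
  have : IsFiniteMeasure (volume.restrict C) := ⟨by simpa using hC.measure_lt_top⟩
  obtain ⟨M, hM⟩ := hC.exists_bound_of_continuousOn hf.continuousOn
  have h : MemLp f 2 (volume.restrict C) := by
    refine MemLp.of_bound hf.aestronglyMeasurable M ?_
    filter_upwards [ae_restrict_mem hC.measurableSet] with x hx using hM x hx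
  exact h.mono_measure (Measure.restrict_mono hS le_rfl)

theorem _root_.Continuous.integrableOn_box {f : (Fin n → ℝ) → ℝ} (hf : Continuous f)
    (K : BoxIntegral.Box (Fin n)) : IntegrableOn f (BoxIntegral.Box.Ioo K) :=
  (hf.continuousOn.integrableOn_compact K.isCompact_Icc).mono_set K.Ioo_subset_Icc

theorem integral_eval_of_natDegree_le_one {p : Polynomial ℝ} (hp : p.natDegree ≤ 1) {a b : ℝ}
    (hab : a ≤ b) : ∫ t in Set.Ioo a b, p.eval t = (b - a) * p.eval ((a + b) / 2) := by
  rw [← integral_Ioc_eq_integral_Ioo, ← intervalIntegral.integral_of_le hab,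
    Polynomial.eq_X_add_C_of_natDegree_le_one hp]
  simp only [Polynomial.eval_add, Polynomial.eval_mul, Polynomial.eval_C, Polynomial.eval_X]
  rw [intervalIntegral.integral_add (Continuous.intervalIntegrable (by fun_prop) _ _)
      (Continuous.intervalIntegrable (by fun_prop) _ _),
    intervalIntegral.integral_const_mul, integral_id, intervalIntegral.integral_const]
  simp only [smul_eq_mul]
  ring

theorem integral_prod_eval {p : Fin n → Polynomial ℝ} (hp : ∀ i, (p i).natDegree ≤ 1)
    (K : BoxIntegral.Box (Fin n)) :
    ∫ x in BoxIntegral.Box.Ioo K, ∏ i, (p i).eval (x i) =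
      vol K * ∏ i, (p i).eval (centre K i) := by
  have hK : (volume : Measure (Fin n → ℝ)).restrict (BoxIntegral.Box.Ioo K) =
      Measure.pi fun i => volume.restrict (Set.Ioo (K.lower i) (K.upper i)) :=
    Measure.restrict_pi_pi _ _
  rw [hK, integral_fintype_prod_eq_prod (𝕜 := ℝ) fun i t => (p i).eval t, vol,
    ← Finset.prod_mul_distrib]
  exact Finset.prod_congr rfl fun i _ =>
    integral_eval_of_natDegree_le_one (hp i) (K.lower_le_upper i)

/-- For each i, one of s and its complement contains i, so one factor is constant in x_i and the
product has degree at most one in x_i. Fubini and the one-dimensional midpoint rule finish. -/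
theorem integral_QCoeff_mul {f g : (Fin n → ℝ) → ℝ} (hf : f ∈ QCoeff s) (hg : g ∈ QCoeff sᶜ)
    (K : BoxIntegral.Box (Fin n)) :
    ∫ x in BoxIntegral.Box.Ioo K, f x * g x = vol K * (f (centre K) * g (centre K)) := by
  have hint : ∀ {u v : (Fin n → ℝ) → ℝ}, u ∈ QCoeff s → v ∈ QCoeff sᶜ →
      IntegrableOn (fun x => u x * v x) (BoxIntegral.Box.Ioo K) := fun hu hv =>
    ((contDiff_of_mem_QCoeff hu).continuous.mul
      (contDiff_of_mem_QCoeff hv).continuous).integrableOn_box K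
  induction hf using QCoeff_induction with
  | prod p hp =>
    induction hg using QCoeff_induction with
    | prod q hq =>
      have hdeg : ∀ i, (p i * q i).natDegree ≤ 1 := fun i => by
        refine Polynomial.natDegree_mul_le.trans ?_
        have h1 := hp i
        have h2 := hq i
        simp only [Finset.mem_compl] at h2
        by_cases h : i ∈ s <;> simp only [h, not_true_eq_false, not_false_eq_true, if_true,
          if_false] at h1 h2 <;> omega
      have := integral_prod_eval hdeg K
      simpa only [Polynomial.eval_mul, Finset.prod_mul_distrib] using this
    | zero => simp
    | add u hu v hv h1 h2 =>
      simp only [Pi.add_apply, mul_add]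
      rw [integral_add (hint (prod_mem_QCoeff hp) hu) (hint (prod_mem_QCoeff hp) hv), h1, h2]
    | smul c u hu h =>
      simp only [Pi.smul_apply, smul_eq_mul, mul_left_comm _ c]
      rw [integral_const_mul, h]
  | zero => simp
  | add u hu v hv h1 h2 =>
    simp only [Pi.add_apply, add_mul, mul_add]
    rw [integral_add (hint hu hg) (hint hv hg), h1, h2]
  | smul c u hu h =>
    simp only [Pi.smul_apply, smul_eq_mul, mul_assoc]
    rw [integral_const_mul, h]
    ring

/-! ### The Hodge star -/

/-- The sign of the Hodge star: `⋆ dx^{τᶜ} = starSign τ dx^τ`. -/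
noncomputable def starSign (τ : Finset (Fin n)) : ℝ :=
  (-1) ^ ((τᶜ ×ˢ τ).filter fun p => p.1 < p.2).card

theorem starSign_mul_self (τ : Finset (Fin n)) : starSign τ * starSign τ = 1 := by
  rw [starSign, ← pow_add, ← two_mul, pow_mul]
  simp

theorem starSign_eq_prod (τ : Finset (Fin n)) : starSign τ = ∏ b ∈ τ, sgn b τᶜ := by
  unfold starSign sgn
  rw [Finset.prod_pow_eq_pow_sum]
  congr 1
  rw [Finset.card_filter, Finset.sum_product_right]
  simp only [Finset.card_filter]

/-- Moving i from τ into the complement drops the factor of i from the product in `starSign_eq_prod`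
and flips the factor of every b > i in τ. The number of these b is k minus the number of elements of
τ below i, whence the sign (-1)^k. -/
theorem starSign_mul_starSign_erase {τ : Finset (Fin n)} {i : Fin n} (hi : i ∈ τ)
    (hτ : τ.card = k + 1) :
    starSign τ * sgn i τᶜ * ((-1) ^ k * starSign (τ.erase i)) = sgn i τ := by
  have h1 : ∀ b ∈ τ.erase i, sgn b (τ.erase i)ᶜ = sgn b τᶜ * if i < b then -1 else 1 := by
    intro b _
    have hi' : i ∉ τᶜ.filter (· < b) := by simp [hi]
    rw [Finset.compl_erase]
    unfold sgn
    rw [Finset.filter_insert]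
    split_ifs with h
    · rw [Finset.card_insert_of_notMem hi', pow_succ]
    · rw [mul_one]
  have h2 : ∏ b ∈ τ.erase i, (if i < b then (-1 : ℝ) else 1) = (-1) ^ k * sgn i τ := by
    rw [Finset.prod_ite, Finset.prod_const, Finset.prod_const_one, mul_one, ← sgn_erase_self, sgn]
    have hc := Finset.card_filter_add_card_filter_not (s := τ.erase i) (· < i)
    rw [Finset.card_erase_of_mem hi, hτ] at hc
    have hn : (τ.erase i).filter (fun b => ¬ b < i) = (τ.erase i).filter (i < ·) := by
      refine Finset.filter_congr fun b hb => ?_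
      have := Finset.ne_of_mem_erase hb
      exact not_lt.trans ⟨fun h => lt_of_le_of_ne h this.symm, le_of_lt⟩
    rw [hn, Nat.add_sub_cancel] at hc
    rw [← hc, pow_add]
    have := sgn_mul_self i (τ.erase i)
    rw [sgn] at this
    rw [mul_right_comm, this, one_mul]
  have h3 : starSign (τ.erase i) = starSign τ * sgn i τᶜ * ((-1) ^ k * sgn i τ) := by
    rw [starSign_eq_prod (τ.erase i), Finset.prod_congr rfl h1, Finset.prod_mul_distrib, h2,
      starSign_eq_prod τ, ← Finset.mul_prod_erase τ _ hi]
    have := sgn_mul_self i τᶜ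
    linear_combination (-(∏ x ∈ τ.erase i, sgn x τᶜ) * (-1) ^ k * sgn i τ) * this
  rw [h3]
  have h4 : ((-1 : ℝ) ^ k) * (-1) ^ k = 1 := by
    rw [← pow_add, ← two_mul, pow_mul]
    simp
  linear_combination (starSign τ * starSign τ * (sgn i τᶜ * sgn i τᶜ) * sgn i τ) * h4 +
    (starSign τ * starSign τ * sgn i τ) * sgn_mul_self i τᶜ + sgn i τ * starSign_mul_self τ

/-- A right inverse of the Hodge star. -/
noncomputable def starInv (k l : ℕ) (a : Alt n k) : Alt n l :=
  WithLp.toLp 2 fun ρ => if h : ρ.1ᶜ.card = k then starSign ρ.1ᶜ * a ⟨ρ.1ᶜ, h⟩ else 0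

theorem card_compl_IX (τ : IX n k) : τ.1ᶜ.card = n - k := by
  rw [Finset.card_compl, Fintype.card_fin, τ.2]

theorem hodge_apply (l : ℕ) (a : Alt n k) (τ : IX n l) (h : τ.1ᶜ.card = k) :
    hodge k l a τ = starSign τ.1 * a ⟨τ.1ᶜ, h⟩ := by
  simp [hodge, h, starSign]

theorem starInv_apply (l : ℕ) (a : Alt n k) (ρ : IX n l) (τ : IX n k) (h : ρ.1ᶜ = τ.1) :
    starInv k l a ρ = starSign τ.1 * a τ := by
  have h' : ρ.1ᶜ.card = k := by rw [h, τ.2]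
  have e : (⟨ρ.1ᶜ, h'⟩ : IX n k) = τ := Subtype.ext h
  simp only [starInv, h', dif_pos]
  rw [e, h]

theorem hodge_starInv (a : Alt n k) : hodge (n - k) k (starInv k (n - k) a) = a := by
  ext τ
  rw [hodge_apply _ _ _ (card_compl_IX τ), starInv_apply _ _ _ τ (compl_compl _), ← mul_assoc,
    starSign_mul_self, one_mul]

/-! ### The spaces `𝒬₁⁻` and `𝒬₁^{*,-}` -/

/-- The star exchanges σ with its complement up to sign, so it complements the degree restrictions.
For k > n both sides hold trivially, there being no index τ. -/
theorem mem_QMinusStar_iff {ω : (Fin n → ℝ) → Alt n k} :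
    ω ∈ QMinusStar n k ↔ ∀ τ : IX n k, (fun x => ω x τ) ∈ QCoeff τ.1ᶜ := by
  constructor
  · rintro ⟨q, hq, rfl⟩ τ
    have h := card_compl_IX τ
    convert (QCoeff τ.1ᶜ).smul_mem (starSign τ.1) (hq ⟨τ.1ᶜ, h⟩) using 1
    funext x
    exact hodge_apply _ _ _ h
  · intro h
    refine ⟨fun x => starInv k (n - k) (ω x), fun ρ => ?_, ?_⟩
    · by_cases hρ : ρ.1ᶜ.card = k
      · have := (QCoeff ρ.1ᶜᶜ).smul_mem (starSign ρ.1ᶜ) (h ⟨ρ.1ᶜ, hρ⟩)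
        rw [compl_compl] at this
        convert this using 1
        funext x
        exact starInv_apply _ _ _ ⟨ρ.1ᶜ, hρ⟩ rfl
      · simp only [starInv, hρ, dif_neg, not_false_eq_true]
        exact (QCoeff ρ.1).zero_mem
    · funext x
      exact hodge_starInv _

theorem contDiff_of_mem_QMinus {ω : (Fin n → ℝ) → Alt n k} (hω : ω ∈ QMinus n k) :
    ContDiff ℝ (⊤ : ℕ∞) ω :=
  contDiff_euclidean.2 fun σ => contDiff_of_mem_QCoeff (hω σ)

theorem contDiff_of_mem_QMinusStar {ω : (Fin n → ℝ) → Alt n k} (hω : ω ∈ QMinusStar n k) :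
    ContDiff ℝ (⊤ : ℕ∞) ω :=
  contDiff_euclidean.2 fun σ => contDiff_of_mem_QCoeff (mem_QMinusStar_iff.1 hω σ)

theorem dForm_mem_QMinus {ω : (Fin n → ℝ) → Alt n k} (hω : ω ∈ QMinus n k) :
    dForm ω ∈ QMinus n (k + 1) := by
  intro τ
  have : (fun x => dForm ω x τ) =
      ∑ i : τ.1, sgn i.1 τ.1 • pd i.1 (fun y => ω y (τ.del i)) := by
    funext x
    simp [dForm]
  rw [this]
  refine Submodule.sum_mem _ fun i _ => Submodule.smul_mem _ _ ?_
  have h := pd_mem_QCoeff i.1 (hω (τ.del i))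
  have e : insert i.1 (τ.del i).1 = τ.1 := Finset.insert_erase i.2
  rwa [e] at h

theorem codForm_mem_QMinusStar {μ : (Fin n → ℝ) → Alt n (k + 1)}
    (hμ : μ ∈ QMinusStar n (k + 1)) : codForm μ ∈ QMinusStar n k := by
  rw [mem_QMinusStar_iff] at hμ ⊢
  intro σ
  have : (fun x => codForm μ x σ) = -∑ i : (σ.1ᶜ : Finset (Fin n)),
      sgn i.1 σ.1 • pd i.1 (fun y => μ y (σ.ins i)) := by
    funext x
    simp [codForm]
  rw [this]
  refine Submodule.neg_mem _ (Submodule.sum_mem _ fun i _ => Submodule.smul_mem _ _ ?_)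
  have h := pd_mem_QCoeff i.1 (hμ (σ.ins i))
  have e : insert i.1 (σ.ins i).1ᶜ = σ.1ᶜ := by
    change insert i.1 (insert i.1 σ.1)ᶜ = σ.1ᶜ
    rw [Finset.compl_insert, Finset.insert_erase i.2]
  rwa [e] at h

/-- Midpoint quadrature is exact on `𝒬₁⁻ × 𝒬₁^{*,-}`. -/
theorem integral_inner_QMinus {f g : (Fin n → ℝ) → Alt n k} (hf : f ∈ QMinus n k)
    (hg : g ∈ QMinusStar n k) (K : BoxIntegral.Box (Fin n)) :
    ∫ x in BoxIntegral.Box.Ioo K, inner ℝ (f x) (g x) =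
      vol K * inner ℝ (f (centre K)) (g (centre K)) := by
  rw [mem_QMinusStar_iff] at hg
  simp only [PiLp.inner_apply, RCLike.inner_apply, conj_trivial, Finset.mul_sum]
  rw [integral_finsetSum]
  · refine Finset.sum_congr rfl fun σ _ => ?_
    simp only [mul_comm (g _ _)]
    exact integral_QCoeff_mul (hf σ) (hg σ) K
  · exact fun σ _ => ((contDiff_of_mem_QCoeff (hg σ)).continuous.mul
      (contDiff_of_mem_QCoeff (hf σ)).continuous).integrableOn_box K

end Polynomials

/-! ### Whitney forms centred in a cell, and the adjoint projection on one box. -/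

section Whitney

variable {n k : ℕ}

/-! ### Whitney forms -/

/-- The Whitney form `a + κ_{x - c} b`. -/
noncomputable def whitney (c : Fin n → ℝ) (a : Alt n k) (b : Alt n (k + 1)) (x : Fin n → ℝ) :
    Alt n k :=
  a + koszul (x - c) b

theorem koszul_sub (x y : Fin n → ℝ) (b : Alt n (k + 1)) :
    koszul (x - y) b = koszul x b - koszul y b := by
  ext σ
  simp [koszul, mul_sub, sub_mul]

/-- Moving the origin of the Koszul operator to c changes κb only by a constant form, so 𝒫₁⁻ may be
described from any centre; `exists_eq_whitney` is the converse. -/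
theorem whitney_mem_PMinus (c : Fin n → ℝ) (a : Alt n k) (b : Alt n (k + 1)) :
    whitney c a b ∈ PMinus n k := by
  refine Submodule.mem_sup.2 ⟨fun _ => a - koszul c b, ⟨_, rfl⟩, koszulField n k fun _ => b,
    ⟨_, ⟨b, rfl⟩, rfl⟩, ?_⟩
  funext x
  simp only [Pi.add_apply, whitney, koszul_sub]
  change a - koszul c b + koszul x b = _
  abel

theorem exists_eq_whitney (c : Fin n → ℝ) {p : (Fin n → ℝ) → Alt n k} (hp : p ∈ PMinus n k) :
    ∃ a b, p = whitney c a b := by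
  obtain ⟨_, ⟨a, rfl⟩, _, ⟨_, ⟨b, rfl⟩, rfl⟩, rfl⟩ := Submodule.mem_sup.1 hp
  refine ⟨a + koszul c b, b, ?_⟩
  funext x
  simp only [Pi.add_apply, whitney, koszul_sub]
  change a + koszul x b = _
  abel

theorem koszul_zero_left (b : Alt n (k + 1)) : koszul (0 : Fin n → ℝ) b = 0 := by
  ext σ
  simp [koszul]

theorem koszul_zero_right (x : Fin n → ℝ) : koszul x (0 : Alt n (k + 1)) = 0 := by
  ext σ
  simp [koszul]

theorem whitney_centre (c : Fin n → ℝ) (a : Alt n k) (b : Alt n (k + 1)) :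
    whitney c a b c = a := by
  rw [whitney, sub_self, koszul_zero_left, add_zero]

theorem const_mem_QMinus (a : Alt n k) : (fun _ => a) ∈ QMinus n k := fun σ =>
  const_mem_QCoeff (a σ)

/-- The `dx^σ`-coefficient of κb involves only the coordinates x_i with i ∉ σ, each linearly. -/
theorem PMinus_le_QMinus : PMinus n k ≤ QMinus n k := by
  refine sup_le ?_ ?_
  · rintro _ ⟨a, rfl⟩
    exact const_mem_QMinus a
  · rintro _ ⟨_, ⟨b, rfl⟩, rfl⟩ σ
    have : (fun x => koszulField n k (fun _ => b) x σ) =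
        ∑ i : (σ.1ᶜ : Finset (Fin n)), (sgn i.1 σ.1 * b (σ.ins i)) • fun x => x i.1 := by
      funext x
      simp [koszulField, koszul, mul_right_comm]
    rw [this]
    exact Submodule.sum_mem _ fun i _ =>
      Submodule.smul_mem _ _ (coord_mem_QCoeff (Finset.mem_compl.1 i.2))

theorem PMinusStar_le_QMinusStar : PMinusStar n k ≤ QMinusStar n k :=
  Submodule.map_mono PMinus_le_QMinus

theorem pd_affine (s : Finset (Fin n)) (a : ℝ) (w c : Fin n → ℝ) (i : Fin n) (x : Fin n → ℝ) :
    pd i (fun y => a + ∑ j ∈ s, w j * (y j - c j)) x = if i ∈ s then w i else 0 := by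
  have hp : ∀ j, DifferentiableAt ℝ (fun y : Fin n → ℝ => y j - c j) x := fun j =>
    (differentiableAt_apply (𝕜 := ℝ) (F' := fun _ : Fin n => ℝ) j x).sub_const _
  have h1 : pd i (fun y => a + ∑ j ∈ s, w j * (y j - c j)) x =
      pd i (fun y => ∑ j ∈ s, w j * (y j - c j)) x := by
    unfold pd
    rw [fderiv_const_add]
  have h2 : ∀ j, pd i (fun y : Fin n → ℝ => y j - c j) x = if i = j then 1 else 0 := by
    intro j
    unfold pd
    rw [fderiv_sub_const, (hasFDerivAt_apply (𝕜 := ℝ) (F' := fun _ : Fin n => ℝ) j x).fderiv]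
    simp [Pi.single_apply, eq_comm]
  rw [h1, pd_sum s i w fun j _ => hp j]
  simp [h2]

/-- Each of the k+1 indices i ∈ τ contributes b τ, its sign appearing once in d and once in κ. -/
theorem dForm_whitney (c : Fin n → ℝ) (a : Alt n k) (b : Alt n (k + 1)) (x : Fin n → ℝ) :
    dForm (whitney c a b) x = ((k : ℝ) + 1) • b := by
  ext τ
  have h : ∀ i : τ.1, pd i.1 (fun y => whitney c a b y (τ.del i)) x = sgn i.1 τ.1 * b τ := by
    intro i
    have hf : (fun y => whitney c a b y (τ.del i)) = fun y => a (τ.del i) +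
        ∑ j ∈ (τ.del i).1ᶜ, (if hj : j ∈ (τ.del i).1ᶜ then
          sgn j (τ.del i).1 * b ((τ.del i).ins ⟨j, hj⟩) else 0) * (y j - c j) := by
      funext y
      rw [← Finset.sum_coe_sort]
      simp only [whitney, koszul, PiLp.add_apply, Pi.sub_apply]
      congr 1
      refine Finset.sum_congr rfl fun j _ => ?_
      rw [dif_pos j.2]
      ring
    have hi : i.1 ∈ (τ.del i).1ᶜ := by simp [IX.del]
    have e : (τ.del i).ins ⟨i.1, hi⟩ = τ := Subtype.ext (Finset.insert_erase i.2)
    rw [hf, pd_affine, if_pos hi, dif_pos hi, e]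
    congr 1
    exact sgn_erase_self _ _
  change ∑ i : τ.1, _ = ((k : ℝ) + 1) * b τ
  simp only [h, ← mul_assoc, sgn_mul_self, one_mul]
  simp [τ.2]

/-- The exterior product of `∑ i, x i dx^i` with a form. -/
noncomputable def wedgePos (x : Fin n → ℝ) (e : Alt n k) : Alt n (k + 1) :=
  WithLp.toLp 2 fun τ => ∑ i : τ.1, sgn i.1 τ.1 * x i.1 * e (τ.del i)

/-- Each of the n - k indices outside σ contributes one copy of e σ. The factor is nonzero for k <
n, so these forms detect the value of a Whitney form at the centre. -/
theorem codForm_wedgePos (e : Alt n k) (x : Fin n → ℝ) :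
    codForm (fun y => wedgePos y e) x = -((n - k : ℕ) : ℝ) • e := by
  ext σ
  have h : ∀ i : (σ.1ᶜ : Finset (Fin n)),
      pd i.1 (fun y => wedgePos y e (σ.ins i)) x = sgn i.1 σ.1 * e σ := by
    intro i
    have hf : (fun y => wedgePos y e (σ.ins i)) = fun y => 0 +
        ∑ j ∈ (σ.ins i).1, (if hj : j ∈ (σ.ins i).1 then
          sgn j (σ.ins i).1 * e ((σ.ins i).del ⟨j, hj⟩) else 0) * (y j - (0 : Fin n → ℝ) j) := by
      funext y
      rw [← Finset.sum_coe_sort, zero_add]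
      simp only [wedgePos]
      refine Finset.sum_congr rfl fun j _ => ?_
      rw [dif_pos j.2]
      simp
      ring
    have hi : i.1 ∈ (σ.ins i).1 := by simp [IX.ins]
    have e : (σ.ins i).del ⟨i.1, hi⟩ = σ :=
      Subtype.ext (Finset.erase_insert (Finset.mem_compl.1 i.2))
    rw [hf, pd_affine, if_pos hi, dif_pos hi, e]
    congr 1
    exact sgn_insert_self _ _
  change -∑ i : (σ.1ᶜ : Finset (Fin n)), _ = -((n - k : ℕ) : ℝ) * e σ
  simp only [h, ← mul_assoc, sgn_mul_self, one_mul]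
  simp [card_compl_IX]

theorem const_mem_PMinusStar (a : Alt n k) : (fun _ => a) ∈ PMinusStar n k :=
  ⟨fun _ => starInv k (n - k) a, Submodule.mem_sup_left ⟨_, rfl⟩, funext fun _ => hodge_starInv a⟩

/-- Exhibits the wedge with the position form as ⋆κ of a constant form. The degree n - (k+1) + 1 has
the shape that `koszul` requires; it equals n - k as soon as some index τ of size k+1 exists. -/
theorem hodge_koszul_starInv (e : Alt n k) (x : Fin n → ℝ) :
    hodge (n - (k + 1)) (k + 1)
      (koszul x ((-1 : ℝ) ^ k • starInv k (n - (k + 1) + 1) e)) = wedgePos x e := by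
  ext τ
  rw [hodge_apply _ _ _ (card_compl_IX τ)]
  simp only [koszul, wedgePos, Finset.mul_sum]
  refine Fintype.sum_equiv (Equiv.subtypeEquivRight (by simp)) _ _ ?_
  rintro ⟨i, hi⟩
  have hi' : i ∈ τ.1 := by simpa using hi
  have hc : (insert i τ.1ᶜ)ᶜ = τ.1.erase i := by rw [Finset.compl_insert, compl_compl]
  have hs : starInv k (n - (k + 1) + 1) e (IX.ins ⟨τ.1ᶜ, card_compl_IX τ⟩ ⟨i, hi⟩) =
      starSign (τ.1.erase i) * e (τ.del ⟨i, hi'⟩) := starInv_apply _ _ _ (τ.del ⟨i, hi'⟩) hc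
  simp only [PiLp.smul_apply, smul_eq_mul, hs]
  change _ = sgn i τ.1 * x i * e (τ.del ⟨i, hi'⟩)
  rw [← starSign_mul_starSign_erase hi' τ.2]
  ring

theorem wedgePos_mem_PMinusStar (e : Alt n k) :
    (fun x => wedgePos x e) ∈ PMinusStar n (k + 1) :=
  ⟨koszulField _ _ fun _ => (-1 : ℝ) ^ k • starInv k (n - (k + 1) + 1) e,
    Submodule.mem_sup_right ⟨_, ⟨_, rfl⟩, rfl⟩, funext fun x => hodge_koszul_starInv e x⟩

/-! ### The local adjoint projection -/

variable {K : BoxIntegral.Box (Fin n)}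

theorem exists_L2Form_ae_eq {f : (Fin n → ℝ) → Alt n k} (hf : Continuous f)
    (K : BoxIntegral.Box (Fin n)) :
    ∃ ω : L2Form k (BoxIntegral.Box.Ioo K), ω =ᵐ[volume.restrict (BoxIntegral.Box.Ioo K)] f :=
  ⟨(memLp_two_of_subset_isCompact hf K.isCompact_Icc K.Ioo_subset_Icc).toLp f,
    MemLp.coeFn_toLp _⟩

theorem inner_eq_vol_mul {ω η : L2Form k (BoxIntegral.Box.Ioo K)}
    {f g : (Fin n → ℝ) → Alt n k} (hf : f ∈ QMinus n k) (hg : g ∈ QMinusStar n k)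
    (hω : ω =ᵐ[volume.restrict (BoxIntegral.Box.Ioo K)] f)
    (hη : η =ᵐ[volume.restrict (BoxIntegral.Box.Ioo K)] g) :
    inner ℝ ω η = vol K * inner ℝ (f (centre K)) (g (centre K)) := by
  rw [inner_eq_setIntegral hω hη, integral_inner_QMinus hf hg]

theorem ae_eq_dForm {ω : L2Form k (BoxIntegral.Box.Ioo K)}
    {η : L2Form (k + 1) (BoxIntegral.Box.Ioo K)} {f : (Fin n → ℝ) → Alt n k}
    (hf : ContDiff ℝ (⊤ : ℕ∞) f) (hω : ω =ᵐ[volume.restrict (BoxIntegral.Box.Ioo K)] f)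
    (hη : (ω, η) ∈ weakD k (BoxIntegral.Box.Ioo K)) :
    η =ᵐ[volume.restrict (BoxIntegral.Box.Ioo K)] dForm f := by
  obtain ⟨η', hη'⟩ := exists_L2Form_ae_eq (contDiff_dForm hf).continuous K
  rwa [weakD_unique (isOpen_Ioo K) hη (mem_weakD_of_ae_eq hf hω hη')]

theorem ae_eq_codForm {μ : L2Form (k + 1) (BoxIntegral.Box.Ioo K)}
    {ν : L2Form k (BoxIntegral.Box.Ioo K)} {f : (Fin n → ℝ) → Alt n (k + 1)}
    (hf : ContDiff ℝ (⊤ : ℕ∞) f) (hμ : μ =ᵐ[volume.restrict (BoxIntegral.Box.Ioo K)] f)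
    (hν : (μ, ν) ∈ weakCod k (BoxIntegral.Box.Ioo K)) :
    ν =ᵐ[volume.restrict (BoxIntegral.Box.Ioo K)] codForm f := by
  obtain ⟨ν', hν'⟩ := exists_L2Form_ae_eq (contDiff_codForm hf).continuous K
  rwa [weakCod_unique (isOpen_Ioo K) hν (mem_weakCod_of_ae_eq hf hμ hν')]

/-- The pairing `⟨dω, μ⟩ - ⟨ω, δμ⟩` on a box, for `ω` in `𝒬₁⁻` and `μ` in `𝒬₁^{*,-}`, only sees the
values of `ω` and `dω` at the centre. -/
theorem pairing_eq {ω : L2Form k (BoxIntegral.Box.Ioo K)}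
    {η : L2Form (k + 1) (BoxIntegral.Box.Ioo K)} {μ : L2Form (k + 1) (BoxIntegral.Box.Ioo K)}
    {ν : L2Form k (BoxIntegral.Box.Ioo K)} {f : (Fin n → ℝ) → Alt n k}
    {g : (Fin n → ℝ) → Alt n (k + 1)} (hf : f ∈ QMinus n k) (hg : g ∈ QMinusStar n (k + 1))
    (hω : ω =ᵐ[volume.restrict (BoxIntegral.Box.Ioo K)] f)
    (hη : (ω, η) ∈ weakD k (BoxIntegral.Box.Ioo K))
    (hμ : μ =ᵐ[volume.restrict (BoxIntegral.Box.Ioo K)] g)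
    (hν : (μ, ν) ∈ weakCod k (BoxIntegral.Box.Ioo K)) :
    inner ℝ η μ - inner ℝ ω ν = vol K * (inner ℝ (dForm f (centre K)) (g (centre K)) -
      inner ℝ (f (centre K)) (codForm g (centre K))) := by
  rw [inner_eq_vol_mul (dForm_mem_QMinus hf) hg
      (ae_eq_dForm (contDiff_of_mem_QMinus hf) hω hη) hμ,
    inner_eq_vol_mul hf (codForm_mem_QMinusStar hg) hω
      (ae_eq_codForm (contDiff_of_mem_QMinusStar hg) hμ hν)]
  ring

/-- The Whitney form with the same value and the same exterior derivative at the centre of `K`. -/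
noncomputable def centralProj (K : BoxIntegral.Box (Fin n)) (f : (Fin n → ℝ) → Alt n k) :
    (Fin n → ℝ) → Alt n k :=
  whitney (centre K) (f (centre K)) (((k : ℝ) + 1)⁻¹ • dForm f (centre K))

theorem centralProj_mem_PMinus (f : (Fin n → ℝ) → Alt n k) : centralProj K f ∈ PMinus n k :=
  whitney_mem_PMinus _ _ _

theorem centralProj_centre (f : (Fin n → ℝ) → Alt n k) :
    centralProj K f (centre K) = f (centre K) :=
  whitney_centre _ _ _

theorem dForm_centralProj (f : (Fin n → ℝ) → Alt n k) (x : Fin n → ℝ) :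
    dForm (centralProj K f) x = dForm f (centre K) := by
  have : ((k : ℝ) + 1) ≠ 0 := by positivity
  rw [centralProj, dForm_whitney, smul_inv_smul₀ this]

/-- Write the Whitney form as a + κ_{x-c} b. Constant test forms have δ = 0 and give b = 0; test
forms x ∧ a then give a = 0 when k < n. For k = n the separate L² condition replaces the second
test. -/
theorem eq_zero_of_zero_mem_adjProjGraph {p : L2Form k (BoxIntegral.Box.Ioo K)}
    (hp : ((0 : L2Form k (BoxIntegral.Box.Ioo K)), p) ∈ adjProjGraph k (BoxIntegral.Box.Ioo K)) :
    p = 0 := by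
  have hvol := (vol_pos K).ne'
  obtain ⟨⟨P, hP, hpP⟩, ⟨η, dp, hη, hdp, hpair⟩, htop⟩ := hp
  simp only [extD_graph (isOpen_Ioo K), codD_graph (isOpen_Ioo K)] at hη hdp hpair hpP htop
  obtain rfl := eq_zero_of_zero_mem_weakD (isOpen_Ioo K) hη
  obtain ⟨a, b, rfl⟩ := exists_eq_whitney (centre K) hP
  have hQ := PMinus_le_QMinus hP
  have hk1 : ((k : ℝ) + 1) ≠ 0 := by positivity
  have key : ∀ g ∈ PMinusStar n (k + 1),
      inner ℝ (((k : ℝ) + 1) • b) (g (centre K)) - inner ℝ a (codForm g (centre K)) = 0 := by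
    intro g hg
    have hg' := PMinusStar_le_QMinusStar hg
    have hsm := contDiff_of_mem_QMinusStar hg'
    obtain ⟨μ, hμ⟩ := exists_L2Form_ae_eq hsm.continuous K
    obtain ⟨ν, hν⟩ := exists_L2Form_ae_eq (contDiff_codForm hsm).continuous K
    have hμν := mem_weakCod_of_ae_eq hsm hμ hν
    have h1 := hpair μ ⟨g, hg, hμ⟩ ν hμν
    rw [pairing_eq hQ hg' hpP hdp hμ hμν, dForm_whitney, whitney_centre] at h1
    simpa [hvol] using h1
  have hb : b = 0 := by
    have h1 := key _ (const_mem_PMinusStar b)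
    have h2 : codForm (fun _ : Fin n → ℝ => b) (centre K) = 0 := by
      ext σ
      simp [codForm, pd]
    rw [h2, inner_zero_right, sub_zero, real_inner_smul_left] at h1
    exact inner_self_eq_zero.1 ((mul_eq_zero.1 h1).resolve_left hk1)
  have ha : a = 0 := by
    rcases lt_trichotomy k n with h | h | h
    · have h1 := key _ (wedgePos_mem_PMinusStar a)
      rw [codForm_wedgePos, hb, smul_zero, inner_zero_left, zero_sub, neg_eq_zero,
        real_inner_smul_right] at h1
      have h2 : -((n - k : ℕ) : ℝ) ≠ 0 := by
        rw [neg_ne_zero]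
        exact_mod_cast (Nat.sub_pos_of_lt h).ne'
      exact inner_self_eq_zero.1 ((mul_eq_zero.1 h1).resolve_left h2)
    · obtain ⟨c, hc⟩ := exists_L2Form_ae_eq (continuous_const (y := a)) K
      have h1 := htop h c ⟨_, ⟨a, rfl⟩, hc⟩
      rw [inner_zero_left, inner_eq_vol_mul hQ
        (PMinusStar_le_QMinusStar (const_mem_PMinusStar a)) hpP hc, whitney_centre] at h1
      exact inner_self_eq_zero.1 ((mul_eq_zero.1 h1).resolve_left hvol)
    -- For k > n there are no k-indices, so a lies in the zero space.
    · ext σ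
      have h1 := σ.1.card_le_univ
      rw [Fintype.card_fin, σ.2] at h1
      omega
  rw [Lp.eq_zero_iff_ae_eq_zero]
  filter_upwards [hpP] with x hx
  rw [hx, ha, hb, whitney, koszul_zero_right, add_zero, Pi.zero_apply]

theorem adjProj_graph : (adjProj k (BoxIntegral.Box.Ioo K)).graph =
    adjProjGraph k (BoxIntegral.Box.Ioo K) :=
  Submodule.toLinearPMap_graph_eq _ fun ⟨_, _⟩ hp h0 => by
    obtain rfl := h0
    exact eq_zero_of_zero_mem_adjProjGraph hp

theorem adjProj_unique {ω p p' : L2Form k (BoxIntegral.Box.Ioo K)}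
    (h : (ω, p) ∈ (adjProj k (BoxIntegral.Box.Ioo K)).graph)
    (h' : (ω, p') ∈ (adjProj k (BoxIntegral.Box.Ioo K)).graph) : p = p' := by
  rw [adjProj_graph] at h h'
  have := Submodule.sub_mem _ h h'
  rw [Prod.mk_sub_mk, sub_self] at this
  exact sub_eq_zero.1 (eq_zero_of_zero_mem_adjProjGraph this)

/-- On `𝒬₁⁻` the adjoint projection is `centralProj`. -/
theorem mem_adjProj_graph {ω p : L2Form k (BoxIntegral.Box.Ioo K)} {f : (Fin n → ℝ) → Alt n k}
    (hf : f ∈ QMinus n k) (hω : ω =ᵐ[volume.restrict (BoxIntegral.Box.Ioo K)] f)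
    (hp : p =ᵐ[volume.restrict (BoxIntegral.Box.Ioo K)] centralProj K f) :
    (ω, p) ∈ (adjProj k (BoxIntegral.Box.Ioo K)).graph := by
  have hP := centralProj_mem_PMinus (K := K) f
  have hQ := PMinus_le_QMinus hP
  have hf' := contDiff_of_mem_QMinus hf
  have hQ' := contDiff_of_mem_QMinus hQ
  obtain ⟨η, hη⟩ := exists_L2Form_ae_eq (contDiff_dForm hf').continuous K
  obtain ⟨dp, hdp⟩ := exists_L2Form_ae_eq (contDiff_dForm hQ').continuous K
  have h1 := mem_weakD_of_ae_eq hf' hω hη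
  have h2 := mem_weakD_of_ae_eq hQ' hp hdp
  rw [adjProj_graph]
  refine ⟨⟨_, hP, hp⟩, ⟨η, dp, ?_, ?_, ?_⟩, ?_⟩
  · rwa [extD_graph (isOpen_Ioo K)]
  · rwa [extD_graph (isOpen_Ioo K)]
  · rintro μ ⟨g, hg, hμ⟩ ν hν
    rw [codD_graph (isOpen_Ioo K)] at hν
    have hg' := PMinusStar_le_QMinusStar hg
    rw [pairing_eq hf hg' hω h1 hμ hν, pairing_eq hQ hg' hp h2 hμ hν, centralProj_centre,
      dForm_centralProj]
  · rintro - c ⟨_, ⟨a, rfl⟩, hc⟩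
    have ha := PMinusStar_le_QMinusStar (const_mem_PMinusStar a)
    rw [inner_eq_vol_mul hf ha hω hc, inner_eq_vol_mul hQ ha hp hc, centralProj_centre]

end Whitney

/-! ### From one cell to the mesh: the discrete spaces, the cochain maps, the constants. -/

section Mesh

variable {n k : ℕ} {Ω : Set (Fin n → ℝ)}

/-! ### The discrete spaces on a mesh -/

/-- Turns a relation that is linear, single-valued and solvable into a linear map. All of d, d_h and
the projection are given as graphs and become arrows in this way. -/
theorem exists_linearMap_of_unique {E F : Type*} [AddCommGroup E] [Module ℝ E] [AddCommGroup F]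
    [Module ℝ F] {R : E → F → Prop} (S : Submodule ℝ E) (T : Submodule ℝ F)
    (hadd : ∀ {a b c d}, R a c → R b d → R (a + b) (c + d))
    (hsmul : ∀ (r : ℝ) {a c}, R a c → R (r • a) (r • c))
    (huniq : ∀ {a c d}, R a c → R a d → c = d) (hex : ∀ a ∈ S, ∃ c ∈ T, R a c) :
    ∃ f : S →ₗ[ℝ] T, ∀ a : S, R a (f a) := by
  choose! f hfT hf using hex
  exact ⟨{ toFun := fun a => ⟨f a, hfT a a.2⟩
           map_add' := fun a b => Subtype.ext <|
             huniq (hf _ (S.add_mem a.2 b.2)) (hadd (hf a a.2) (hf b b.2))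
           map_smul' := fun r a => Subtype.ext <|
             huniq (hf _ (S.smul_mem r a.2)) (hsmul r (hf a a.2)) }, fun a => hf a a.2⟩

namespace CubicalMesh

variable (G : CubicalMesh Ω)

theorem measurableSet_cell (K : G.cells) : MeasurableSet (G.cell K) :=
  (isOpen_Ioo K.1).measurableSet

/-- The closed boxes cover Ω and their boundaries are null sets, so global inner products are sums
over the open cells. -/
theorem iUnion_cell_ae_eq : (⋃ K : G.cells, G.cell K) =ᵐ[volume] Ω := by
  have h0 : (⋃ K : G.cells, G.cell K) ⊆ Ω := Set.iUnion_subset fun K => G.interior_subset K.1 K.2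
  refine h0.eventuallyLE.antisymm ?_
  have h1 : (⋃ K : G.cells, BoxIntegral.Box.Icc K.1) =ᵐ[volume] ⋃ K : G.cells, G.cell K :=
    Filter.EventuallyEq.countable_iUnion fun K => (BoxIntegral.Box.Ioo_ae_eq_Icc K.1).symm
  have h2 : Ω ⊆ ⋃ K : G.cells, BoxIntegral.Box.Icc K.1 := fun x hx => by
    obtain ⟨K, hK, hxK⟩ := Set.mem_iUnion₂.1 (G.subset hx)
    exact Set.mem_iUnion.2 ⟨⟨K, hK⟩, hxK⟩
  exact h2.eventuallyLE.trans h1.le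

theorem inner_eq_sum_res (ω η : L2Form k Ω) :
    inner ℝ ω η = ∑ K, inner ℝ (G.res K ω) (G.res K η) := by
  have hint : IntegrableOn (fun x => inner ℝ (ω x) (η x)) Ω := L2.integrable_inner ω η
  rw [L2.inner_def, ← setIntegral_congr_set G.iUnion_cell_ae_eq,
    integral_iUnion_fintype G.measurableSet_cell _ fun K => hint.mono_set
      (G.interior_subset K.1 K.2)]
  · exact Finset.sum_congr rfl fun K _ =>
      (inner_eq_setIntegral (restr_ae_eq _ ω) (restr_ae_eq _ η)).symm
  · exact fun K K' h => G.disjoint K.1 K.2 K'.1 K'.2 fun h' => h (Subtype.ext h')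

theorem mem_conforming_iff {S : Submodule ℝ (L2Form k Ω)}
    {L : Submodule ℝ ((Fin n → ℝ) → Alt n k)} {ω : L2Form k Ω} :
    ω ∈ G.conforming S L ↔ ω ∈ S ∧ ∀ K, G.res K ω ∈ onSet L (G.cell K) := by
  simp [conforming]

variable {G}

theorem IsBrokenD.unique {ω : G.Broken k} {η η' : G.Broken (k + 1)} (h : G.IsBrokenD ω η)
    (h' : G.IsBrokenD ω η') : η = η' :=
  funext fun K => weakD_unique (isOpen_Ioo K.1)
    (by simpa only [extD_graph (isOpen_Ioo K.1)] using h K)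
    (by simpa only [extD_graph (isOpen_Ioo K.1)] using h' K)

theorem IsBrokenProj.unique {ω p p' : G.Broken k} (h : G.IsBrokenProj ω p)
    (h' : G.IsBrokenProj ω p') : p = p' :=
  funext fun K => adjProj_unique (h K) (h' K)

theorem IsBrokenD.add {ω ω' : G.Broken k} {η η' : G.Broken (k + 1)} (h : G.IsBrokenD ω η)
    (h' : G.IsBrokenD ω' η') : G.IsBrokenD (ω + ω') (η + η') := fun K =>
  (extD k (G.cell K)).graph.add_mem (h K) (h' K)

theorem IsBrokenD.smul {ω : G.Broken k} {η : G.Broken (k + 1)} (h : G.IsBrokenD ω η) (r : ℝ) :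
    G.IsBrokenD (r • ω) (r • η) := fun K =>
  (extD k (G.cell K)).graph.smul_mem r (h K)

theorem IsBrokenProj.add_res {ω ω' : L2Form k Ω} {p p' : G.Broken k}
    (h : G.IsBrokenProj (fun K => G.res K ω) p) (h' : G.IsBrokenProj (fun K => G.res K ω') p') :
    G.IsBrokenProj (fun K => G.res K (ω + ω')) (p + p') := fun K => by
  beta_reduce
  rw [map_add]
  exact (adjProj k (G.cell K)).graph.add_mem (h K) (h' K)

theorem IsBrokenProj.smul_res {ω : L2Form k Ω} {p : G.Broken k}
    (h : G.IsBrokenProj (fun K => G.res K ω) p) (r : ℝ) :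
    G.IsBrokenProj (fun K => G.res K (r • ω)) (r • p) := fun K => by
  beta_reduce
  rw [map_smul]
  exact (adjProj k (G.cell K)).graph.smul_mem r (h K)

theorem isBrokenD_iff {ω : G.Broken k} {η : G.Broken (k + 1)} :
    G.IsBrokenD ω η ↔ ∀ K, (ω K, η K) ∈ weakD k (G.cell K) :=
  forall_congr' fun K => by rw [extD_graph (isOpen_Ioo K.1)]

theorem res_dForm_mem {ω : L2Form k Ω} {η : L2Form (k + 1) Ω} (h : (ω, η) ∈ weakD k Ω)
    (K : G.cells) (hω : G.res K ω ∈ onSet (QMinus n k) (G.cell K)) :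
    G.res K η ∈ onSet (QMinus n (k + 1)) (G.cell K) := by
  obtain ⟨f, hf, hωf⟩ := hω
  exact ⟨dForm f, dForm_mem_QMinus hf,
    ae_eq_dForm (contDiff_of_mem_QMinus hf) hωf (weakD_restr (G.interior_subset K.1 K.2) h)⟩

theorem res_codForm_mem {μ : L2Form (k + 1) Ω} {ν : L2Form k Ω} (h : (μ, ν) ∈ weakCod k Ω)
    (K : G.cells) (hμ : G.res K μ ∈ onSet (QMinusStar n (k + 1)) (G.cell K)) :
    G.res K ν ∈ onSet (QMinusStar n k) (G.cell K) := by
  obtain ⟨f, hf, hμf⟩ := hμ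
  exact ⟨codForm f, codForm_mem_QMinusStar hf,
    ae_eq_codForm (contDiff_of_mem_QMinusStar hf) hμf
      (weakCod_restr (G.interior_subset K.1 K.2) h)⟩

theorem exists_weakD_mem_V {ω : L2Form k Ω} (hω : ω ∈ G.V k) :
    ∃ η ∈ G.V (k + 1), (ω, η) ∈ weakD k Ω := by
  obtain ⟨h1, h2⟩ := (G.mem_conforming_iff).1 hω
  obtain ⟨η, hη⟩ := mem_H_iff.1 h1
  exact ⟨η, (G.mem_conforming_iff).2 ⟨mem_H_iff.2 ⟨0, weakD_snd_zero hη⟩,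
    fun K => res_dForm_mem hη K (h2 K)⟩, hη⟩

theorem exists_weakD_mem_V0 {ω : L2Form k Ω} (hω : ω ∈ G.V0 k) :
    ∃ η ∈ G.V0 (k + 1), (ω, η) ∈ weakD k Ω := by
  obtain ⟨h1, h2⟩ := (G.mem_conforming_iff).1 hω
  obtain ⟨η, hη⟩ := mem_H0_iff.1 h1
  have hη' := closure_testD_le_weakD hη
  exact ⟨η, (G.mem_conforming_iff).2 ⟨mem_H0_iff.2 ⟨0, closure_testD_snd_zero hη⟩,
    fun K => res_dForm_mem hη' K (h2 K)⟩, hη'⟩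

theorem mem_VStar_of_weakCod {μ : L2Form (k + 1 + 1) Ω} {ν : L2Form (k + 1) Ω}
    (hμ : μ ∈ G.VStar (k + 1)) (hν : (μ, ν) ∈ weakCod (k + 1) Ω) : ν ∈ G.VStar k :=
  (G.mem_conforming_iff).2 ⟨mem_HStar_iff.2 ⟨0, weakCod_snd_zero hν⟩,
    fun K => res_codForm_mem hν K (((G.mem_conforming_iff).1 hμ).2 K)⟩

/-- Membership in `HStar0` supplies some limit of the codifferentials of test forms; uniqueness of
the weak codifferential identifies it with ν. -/
theorem mem_VStar0_of_weakCod (hΩ : IsOpen Ω) {μ : L2Form (k + 1 + 1) Ω} {ν : L2Form (k + 1) Ω}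
    (hμ : μ ∈ G.VStar0 (k + 1)) (hν : (μ, ν) ∈ weakCod (k + 1) Ω) : ν ∈ G.VStar0 k := by
  obtain ⟨h1, h2⟩ := (G.mem_conforming_iff).1 hμ
  obtain ⟨ν', hν'⟩ := mem_HStar0_iff.1 h1
  obtain rfl := weakCod_unique hΩ hν (closure_testCod_le_weakCod hν')
  exact (G.mem_conforming_iff).2 ⟨mem_HStar0_iff.2 ⟨0, closure_testCod_snd_zero hν'⟩,
    fun K => res_codForm_mem hν K (h2 K)⟩

/-- The derivative of a Whitney form is constant on each cell, so it is again Whitney and has zero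
broken derivative. The defining condition left for it, that the sum of ⟨dω, δμ⟩ over the cells
vanishes, is the condition for ω tested with δμ. -/
theorem exists_brokenD_mem_whitneySpace (hΩ : IsOpen Ω) {M : Submodule ℝ (L2Form (k + 1) Ω)}
    {M' : Submodule ℝ (L2Form (k + 1 + 1) Ω)}
    (hM : ∀ μ ∈ M', ∀ ν, (μ, ν) ∈ weakCod (k + 1) Ω → ν ∈ M) {ω : G.Broken k}
    (hω : ω ∈ G.whitneySpace M) : ∃ η ∈ G.whitneySpace M', G.IsBrokenD ω η := by
  obtain ⟨h1, η, hη, h2⟩ := hω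
  have hη' := isBrokenD_iff.1 hη
  refine ⟨η, ⟨fun K => ?_, 0, isBrokenD_iff.2 fun K => weakD_snd_zero (hη' K),
    fun μ hμ ν hν => ?_⟩, hη⟩
  · obtain ⟨P, hP, hωP⟩ := h1 K
    have hd := ae_eq_dForm (contDiff_of_mem_QMinus (PMinus_le_QMinus hP)) hωP (hη' K)
    obtain ⟨a, b, rfl⟩ := exists_eq_whitney 0 hP
    refine ⟨fun _ => ((k : ℝ) + 1) • b, Submodule.mem_sup_left ⟨_, rfl⟩, ?_⟩
    filter_upwards [hd] with x hx
    rw [hx, dForm_whitney]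
  · rw [codD_graph hΩ] at hν
    -- The test form is ν = δμ, whose own codifferential is 0.
    have h3 := h2 ν (hM μ hμ ν hν) 0 (by rw [codD_graph hΩ]; exact weakCod_snd_zero hν)
    simp only [map_zero, inner_zero_right, sub_zero] at h3
    simp only [Pi.zero_apply, inner_zero_left, zero_sub, Finset.sum_neg_distrib, h3, neg_zero]

/-- The boundary conditions enter only through `hpair`, so both rows are covered. It matters that
`centralProj` reproduces the pairing with all of 𝒬₁^{*,-}, not just with the 𝒫₁^{*,-} that defines
the projection. -/
theorem exists_proj_mem_whitneySpace (hΩ : IsOpen Ω) {M : Submodule ℝ (L2Form (k + 1) Ω)}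
    {ω : L2Form k Ω} {η : L2Form (k + 1) Ω} (hη : (ω, η) ∈ weakD k Ω)
    (hω : ∀ K, G.res K ω ∈ onSet (QMinus n k) (G.cell K))
    (hM : ∀ μ ∈ M, ∀ K, G.res K μ ∈ onSet (QMinusStar n (k + 1)) (G.cell K))
    (hpair : ∀ μ ∈ M, ∀ ν, (μ, ν) ∈ weakCod k Ω → inner ℝ η μ = inner ℝ ω ν) :
    ∃ p ∈ G.whitneySpace M, G.IsBrokenProj (fun K => G.res K ω) p := by
  choose f hf hωf using hω
  have hP : ∀ K : G.cells, centralProj K.1 (f K) ∈ PMinus n k := fun K =>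
    centralProj_mem_PMinus _
  have hQ := fun K => PMinus_le_QMinus (hP K)
  have hsm := fun K => contDiff_of_mem_QMinus (hQ K)
  choose p hp using fun K : G.cells => exists_L2Form_ae_eq (hsm K).continuous K.1
  choose dp hdp using fun K : G.cells => exists_L2Form_ae_eq (contDiff_dForm (hsm K)).continuous K.1
  have hpd := fun K => mem_weakD_of_ae_eq (hsm K) (hp K) (hdp K)
  refine ⟨p, ⟨fun K => ⟨_, hP K, hp K⟩, dp, isBrokenD_iff.2 hpd, fun μ hμ ν hν => ?_⟩,
    fun K => mem_adjProj_graph (hf K) (hωf K) (hp K)⟩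
  rw [codD_graph hΩ] at hν
  have hcell : ∀ K, inner ℝ (dp K) (G.res K μ) - inner ℝ (p K) (G.res K ν) =
      inner ℝ (G.res K η) (G.res K μ) - inner ℝ (G.res K ω) (G.res K ν) := by
    intro K
    obtain ⟨g, hg, hμg⟩ := hM μ hμ K
    have hν' := weakCod_restr (G.interior_subset K.1 K.2) hν
    rw [pairing_eq (hQ K) hg (hp K) (hpd K) hμg hν', pairing_eq (hf K) hg (hωf K)
      (weakD_restr (G.interior_subset K.1 K.2) hη) hμg hν', centralProj_centre, dForm_centralProj]
  rw [Finset.sum_congr rfl fun K _ => hcell K, Finset.sum_sub_distrib, ← G.inner_eq_sum_res,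
    ← G.inner_eq_sum_res, hpair μ hμ ν hν, sub_self]

theorem exists_proj_mem_W (hΩ : IsOpen Ω) {ω : L2Form k Ω} (hω : ω ∈ G.V k) :
    ∃ p ∈ G.W k, G.IsBrokenProj (fun K => G.res K ω) p := by
  obtain ⟨h1, h2⟩ := (G.mem_conforming_iff).1 hω
  obtain ⟨η, hη⟩ := mem_H_iff.1 h1
  refine exists_proj_mem_whitneySpace hΩ hη h2
    (fun μ hμ => ((G.mem_conforming_iff).1 hμ).2) fun μ hμ ν hν => ?_
  obtain ⟨ν', hν'⟩ := mem_HStar0_iff.1 ((G.mem_conforming_iff).1 hμ).1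
  obtain rfl := weakCod_unique hΩ hν (closure_testCod_le_weakCod hν')
  exact inner_eq_of_mem_closure_testCod hη hν'

theorem exists_proj_mem_W0 (hΩ : IsOpen Ω) {ω : L2Form k Ω} (hω : ω ∈ G.V0 k) :
    ∃ p ∈ G.W0 k, G.IsBrokenProj (fun K => G.res K ω) p := by
  obtain ⟨h1, h2⟩ := (G.mem_conforming_iff).1 hω
  obtain ⟨η, hη⟩ := mem_H0_iff.1 h1
  exact exists_proj_mem_whitneySpace hΩ (closure_testD_le_weakD hη) h2
    (fun μ hμ => ((G.mem_conforming_iff).1 hμ).2)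
    fun μ hμ ν hν => inner_eq_of_mem_closure_testD hη hν

/-- The adjoint projection commutes with the exterior derivative. -/
theorem IsBrokenProj.isBrokenD {ω : L2Form k Ω} {η : L2Form (k + 1) Ω} {p : G.Broken k}
    {p' : G.Broken (k + 1)} (hω : ∀ K, G.res K ω ∈ onSet (QMinus n k) (G.cell K))
    (hη : (ω, η) ∈ weakD k Ω) (hp : G.IsBrokenProj (fun K => G.res K ω) p)
    (hp' : G.IsBrokenD p p') : G.IsBrokenProj (fun K => G.res K η) p' := by
  intro K
  obtain ⟨f, hf, hωf⟩ := hω K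
  have hsm := contDiff_of_mem_QMinus (PMinus_le_QMinus (centralProj_mem_PMinus (K := K.1) f))
  obtain ⟨q, hq⟩ := exists_L2Form_ae_eq hsm.continuous K.1
  -- By uniqueness the given projection is the explicit `centralProj` of f.
  have hpq : p K = q := adjProj_unique (hp K) (mem_adjProj_graph hf hωf hq)
  rw [← hpq] at hq
  refine mem_adjProj_graph (dForm_mem_QMinus hf) (ae_eq_dForm (contDiff_of_mem_QMinus hf) hωf
    (weakD_restr (G.interior_subset K.1 K.2) hη)) ?_
  filter_upwards [ae_eq_dForm hsm hq (isBrokenD_iff.1 hp' K)] with x hx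
  rw [hx, dForm_centralProj, centralProj, dForm_dForm (contDiff_of_mem_QMinus hf), smul_zero,
    whitney, koszul_zero_right, add_zero]

/-- Stated for arbitrary families V and W, so that it yields the diagrams with and without boundary
conditions. The identities between composites follow from uniqueness of the values. -/
theorem exists_cochain_maps (hΩ : IsOpen Ω) {V : ∀ k, Submodule ℝ (L2Form k Ω)}
    {W : ∀ k, Submodule ℝ (G.Broken k)}
    (hV : ∀ k, ∀ ω ∈ V k, ∃ η ∈ V (k + 1), (ω, η) ∈ weakD k Ω)
    (hQ : ∀ k, ∀ ω ∈ V k, ∀ K, G.res K ω ∈ onSet (QMinus n k) (G.cell K))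
    (hW : ∀ k, ∀ ω ∈ W k, ∃ η ∈ W (k + 1), G.IsBrokenD ω η)
    (hI : ∀ k, ∀ ω ∈ V k, ∃ p ∈ W k, G.IsBrokenProj (fun K => G.res K ω) p) :
    ∃ (dV : ∀ k, V k →ₗ[ℝ] V (k + 1)) (dW : ∀ k, W k →ₗ[ℝ] W (k + 1))
      (I : ∀ k, V k →ₗ[ℝ] W k),
      (∀ k (ω : V k), ((ω : L2Form k Ω), (dV k ω : L2Form (k + 1) Ω)) ∈ (extD k Ω).graph) ∧
      (∀ k (ω : W k), G.IsBrokenD (ω : G.Broken k) (dW k ω : G.Broken (k + 1))) ∧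
      (∀ k (ω : V k),
        G.IsBrokenProj (fun K => G.res K (ω : L2Form k Ω)) (I k ω : G.Broken k)) ∧
      (∀ k, dV (k + 1) ∘ₗ dV k = 0) ∧ (∀ k, dW (k + 1) ∘ₗ dW k = 0) ∧
      (∀ k, I (k + 1) ∘ₗ dV k = dW k ∘ₗ I k) := by
  have hdV : ∀ k, ∃ f : V k →ₗ[ℝ] V (k + 1), ∀ ω : V k, (ω.1, (f ω).1) ∈ weakD k Ω := fun k =>
    exists_linearMap_of_unique (R := fun ω η => (ω, η) ∈ weakD k Ω) (V k) (V (k + 1))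
      (fun {a b c d} h h' => (weakD k Ω).add_mem (x := (a, c)) (y := (b, d)) h h')
      (fun r a c h => (weakD k Ω).smul_mem (x := (a, c)) r h)
      (fun h h' => weakD_unique hΩ h h') (hV k)
  have hdW : ∀ k, ∃ f : W k →ₗ[ℝ] W (k + 1), ∀ ω : W k, G.IsBrokenD ω.1 (f ω).1 := fun k =>
    exists_linearMap_of_unique (R := fun ω η => G.IsBrokenD ω η) (W k) (W (k + 1))
      IsBrokenD.add (fun r _ _ h => h.smul r) IsBrokenD.unique (hW k)
  have hI : ∀ k, ∃ f : V k →ₗ[ℝ] W k, ∀ ω : V k,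
      G.IsBrokenProj (fun K => G.res K ω.1) (f ω).1 := fun k =>
    exists_linearMap_of_unique (R := fun ω p => G.IsBrokenProj (fun K => G.res K ω) p) (V k) (W k)
      IsBrokenProj.add_res (fun r _ _ h => h.smul_res r) IsBrokenProj.unique (hI k)
  choose dV hdV using hdV
  choose dW hdW using hdW
  choose I hI using hI
  refine ⟨dV, dW, I, fun k ω => ?_, hdW, hI, fun k => ?_, fun k => ?_, fun k => ?_⟩
  · rw [extD_graph hΩ]
    exact hdV k ω
  · exact LinearMap.ext fun ω => Subtype.ext <|
      weakD_unique hΩ (hdV (k + 1) (dV k ω)) (weakD_snd_zero (hdV k ω))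
  · refine LinearMap.ext fun ω => Subtype.ext (IsBrokenD.unique (hdW (k + 1) (dW k ω)) ?_)
    exact isBrokenD_iff.2 fun K => weakD_snd_zero (isBrokenD_iff.1 (hdW k ω) K)
  · exact LinearMap.ext fun ω => Subtype.ext <| IsBrokenProj.unique (hI (k + 1) (dV k ω)) <|
      (hI k ω).isBrokenD (hQ k ω ω.2) (hdV k ω) (hdW k (I k ω))

/-! ### Constants -/

theorem dForm_const (a : Alt n k) : dForm (fun _ : Fin n → ℝ => a) = 0 := by
  funext x
  ext τ
  simp [dForm, pd]

/-- Finitely many boxes cover Ω, so Ω lies in a compact set and constants are square integrable. -/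
theorem exists_const_mem_V (G : CubicalMesh Ω) (a : Alt n 0) :
    ∃ ω ∈ G.V 0, ω =ᵐ[volume.restrict Ω] fun _ => a := by
  have hc : IsCompact (⋃ K ∈ G.cells, BoxIntegral.Box.Icc K) :=
    G.cells.isCompact_biUnion fun K _ => K.isCompact_Icc
  have hm := memLp_two_of_subset_isCompact (continuous_const (y := a)) hc G.subset
  have hω := MemLp.coeFn_toLp hm
  refine ⟨hm.toLp _, (G.mem_conforming_iff).2 ⟨mem_H_iff.2 ⟨0, ?_⟩, fun K => ?_⟩, hω⟩
  · refine mem_weakD_of_ae_eq contDiff_const hω ?_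
    rw [dForm_const]
    exact Lp.coeFn_zero _ _ _
  · exact ⟨_, const_mem_QMinus a, (restr_ae_eq _ _).trans
      (ae_mono (Measure.restrict_mono (G.interior_subset K.1 K.2) le_rfl) hω)⟩

theorem exists_const_linearMap (G : CubicalMesh Ω) : ∃ ι : ℝ →ₗ[ℝ] G.V 0, ∀ c,
    (ι c).1 =ᵐ[volume.restrict Ω] fun _ => WithLp.toLp 2 fun _ => c := by
  obtain ⟨ω, hω, hω1⟩ := exists_const_mem_V G (WithLp.toLp 2 fun _ => 1)
  refine ⟨LinearMap.toSpanSingleton ℝ _ ⟨ω, hω⟩, fun c => ?_⟩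
  filter_upwards [Lp.coeFn_smul c ω, hω1] with x h1 h2
  change (c • ω : L2Form 0 Ω) x = _
  rw [h1, Pi.smul_apply, h2]
  ext σ
  simp

theorem proj_const_ae_eq {ω : L2Form k Ω} {a : Alt n k} (hω : ω =ᵐ[volume.restrict Ω] fun _ => a)
    {p : G.Broken k} (hp : G.IsBrokenProj (fun K => G.res K ω) p) (K : G.cells) :
    p K =ᵐ[volume.restrict (G.cell K)] fun _ => a := by
  have hres : G.res K ω =ᵐ[volume.restrict (G.cell K)] fun _ => a := (restr_ae_eq _ _).trans
    (ae_mono (Measure.restrict_mono (G.interior_subset K.1 K.2) le_rfl) hω)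
  have hproj : centralProj K.1 (fun _ => a) = fun _ => a := by
    funext x
    rw [centralProj, dForm_const, Pi.zero_apply, smul_zero, whitney, koszul_zero_right, add_zero]
  have := adjProj_unique (hp K) (mem_adjProj_graph (const_mem_QMinus a) hres
    (by rw [hproj]; exact hres))
  rw [this]
  exact hres

end CubicalMesh

end Mesh

end CubicalWhitney

/-! ### The two commuting diagrams. -/

theorem mainTheorem2 {n : ℕ} {Ω : Set (Fin n → ℝ)} (hΩ : IsOpen Ω) (G : CubicalWhitney.CubicalMesh Ω) :
    (∃ (ιV : ℝ →ₗ[ℝ] G.V 0) (ιW : ℝ →ₗ[ℝ] G.W 0)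
      (dV : ∀ k, G.V k →ₗ[ℝ] G.V (k + 1)) (dW : ∀ k, G.W k →ₗ[ℝ] G.W (k + 1))
      (I : ∀ k, G.V k →ₗ[ℝ] G.W k),
      -- what the arrows are: constants, exterior derivative, broken derivative, projection
      (∀ c, (ιV c).1 =ᵐ[volume.restrict Ω] fun _ => WithLp.toLp 2 fun _ => c) ∧
      (∀ c K, (ιW c).1 K =ᵐ[volume.restrict (G.cell K)] fun _ => WithLp.toLp 2 fun _ => c) ∧
      (∀ k (ω : G.V k), ((ω : CubicalWhitney.L2Form k Ω), (dV k ω : CubicalWhitney.L2Form (k + 1) Ω)) ∈ (CubicalWhitney.extD k Ω).graph) ∧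
      (∀ k (ω : G.W k), G.IsBrokenD (ω : G.Broken k) (dW k ω : G.Broken (k + 1))) ∧
      (∀ k (ω : G.V k), G.IsBrokenProj (fun K => G.res K (ω : CubicalWhitney.L2Form k Ω)) (I k ω : G.Broken k)) ∧
      -- the rows are complexes
      dV 0 ∘ₗ ιV = 0 ∧ (∀ k, dV (k + 1) ∘ₗ dV k = 0) ∧
      dW 0 ∘ₗ ιW = 0 ∧ (∀ k, dW (k + 1) ∘ₗ dW k = 0) ∧
      -- the squares commute
      I 0 ∘ₗ ιV = ιW ∧ (∀ k, I (k + 1) ∘ₗ dV k = dW k ∘ₗ I k)) ∧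
    (∃ (dV : ∀ k, G.V0 k →ₗ[ℝ] G.V0 (k + 1)) (dW : ∀ k, G.W0 k →ₗ[ℝ] G.W0 (k + 1))
      (I : ∀ k, G.V0 k →ₗ[ℝ] G.W0 k),
      (∀ k (ω : G.V0 k), ((ω : CubicalWhitney.L2Form k Ω), (dV k ω : CubicalWhitney.L2Form (k + 1) Ω)) ∈ (CubicalWhitney.extD k Ω).graph) ∧
      (∀ k (ω : G.W0 k), G.IsBrokenD (ω : G.Broken k) (dW k ω : G.Broken (k + 1))) ∧
      (∀ k (ω : G.V0 k), G.IsBrokenProj (fun K => G.res K (ω : CubicalWhitney.L2Form k Ω)) (I k ω : G.Broken k)) ∧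
      (∀ k, dV (k + 1) ∘ₗ dV k = 0) ∧ (∀ k, dW (k + 1) ∘ₗ dW k = 0) ∧
      (∀ k, I (k + 1) ∘ₗ dV k = dW k ∘ₗ I k)) := by
  have hQ : ∀ {k : ℕ} {S : Submodule ℝ (CubicalWhitney.L2Form k Ω)},
      ∀ ω ∈ G.conforming S (CubicalWhitney.QMinus n k),
      ∀ K, G.res K ω ∈ CubicalWhitney.onSet (CubicalWhitney.QMinus n k) (G.cell K) := fun ω hω =>
    ((G.mem_conforming_iff).1 hω).2
  constructor
  · obtain ⟨dV, dW, I, h1, h2, h3, h4, h5, h6⟩ := CubicalWhitney.CubicalMesh.exists_cochain_maps hΩ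
      (V := G.V) (W := G.W) (fun k ω hω => CubicalWhitney.CubicalMesh.exists_weakD_mem_V hω)
      (fun k => hQ)
      (fun k ω hω => CubicalWhitney.CubicalMesh.exists_brokenD_mem_whitneySpace hΩ
        (fun μ hμ ν hν => CubicalWhitney.CubicalMesh.mem_VStar0_of_weakCod hΩ hμ hν) hω)
      (fun k ω hω => CubicalWhitney.CubicalMesh.exists_proj_mem_W hΩ hω)
    obtain ⟨ιV, hιV⟩ := CubicalWhitney.CubicalMesh.exists_const_linearMap G
    have hd : dV 0 ∘ₗ ιV = 0 := by
      refine LinearMap.ext fun c => Subtype.ext ?_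
      have h := h1 0 (ιV c)
      rw [CubicalWhitney.extD_graph hΩ] at h
      refine CubicalWhitney.weakD_unique hΩ h
        (CubicalWhitney.mem_weakD_of_ae_eq contDiff_const (hιV c) ?_)
      rw [CubicalWhitney.CubicalMesh.dForm_const]
      exact Lp.coeFn_zero _ _ _
    -- Taking the lower map from ℝ to be the projection of the upper one makes the first square
    -- commute by definition; it still sends c to c because constants are their own projections.
    refine ⟨ιV, I 0 ∘ₗ ιV, dV, dW, I, hιV, fun c K =>
      CubicalWhitney.CubicalMesh.proj_const_ae_eq (hιV c) (h3 0 (ιV c)) K,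
      h1, h2, h3, hd, h4, ?_, h5, rfl, h6⟩
    rw [← LinearMap.comp_assoc, ← h6, LinearMap.comp_assoc, hd, LinearMap.comp_zero]
  · exact CubicalWhitney.CubicalMesh.exists_cochain_maps hΩ
      (V := G.V0) (W := G.W0) (fun k ω hω => CubicalWhitney.CubicalMesh.exists_weakD_mem_V0 hω)
      (fun k => hQ)
      (fun k ω hω => CubicalWhitney.CubicalMesh.exists_brokenD_mem_whitneySpace hΩ
        (fun μ hμ ν hν => CubicalWhitney.CubicalMesh.mem_VStar_of_weakCod hμ hν) hω)
      (fun k ω hω => CubicalWhitney.CubicalMesh.exists_proj_mem_W0 hΩ hω)
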